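/- A *compact line* is a linearly ordered set that is compact in its order topology; $C(K)$ denotes the Banach space of continuous real-valued functions on $K$ with the supremum norm, and $c_0$ the Banach space of real null sequences with the supremum norm. A compact Hausdorff space is *$\aleph_0$-monolithic* if each of its separable subspaces is metrizable. A closed subspace $Y$ of a Banach space $X$ has the *$c_0$-extension property in $X$* if every bounded linear operator $T:Y\to c_0$ admits a bounded linear extension $T':X\to c_0$; the space $X$ has the *$c_0$-extension property* (respectively, the *separable $c_0$-extension property*) if every closed subspace (respectively, every separable closed subspace) of $X$ has the $c_0$-extension property in $X$. The space $X$ has the *Sobczyk property* if every closed subspace of $X$ that is isomorphic (linearly homeomorphic) to $c_0$ is complemented in $X$. **Theorem.** Let $K$ be a compact line. The following statements are equivalent: (a) $K$ is $\aleph_0$-monolithic; (b) $C(K)$ has the $c_0$-extension property; (c) $C(K)$ has the separable $c_0$-extension property. Moreover, if $D=[0,1]\times\{0,1\}$ is the double arrow space, endowed with the lexicographic order and the order topology, then $C(D)$ has the Sobczyk property but does not have the separable $c_0$-extension property. -/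

import Mathlib

open scoped ZeroAtInfty Topology

/-- A topological space is `ℵ₀`-monolithic if each of its separable subspaces is metrizable. -/
def IsAlephZeroMonolithic (K : Type*) [TopologicalSpace K] : Prop :=
  ∀ S : Set K, TopologicalSpace.SeparableSpace S → TopologicalSpace.MetrizableSpace S

/-- The real Banach space `c₀` of real sequences converging to zero with the supremum norm. -/
abbrev CZero : Type := C₀(ℕ, ℝ)

section ExtensionProperties

variable {X : Type*} [NormedAddCommGroup X] [NormedSpace ℝ X]

/-- A subspace `Y` has the `c₀`-extension property in `X` if every bounded operator from `Y` to
`c₀` admits a bounded extension to `X`. -/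
def Submodule.HasCZeroExtensionIn (Y : Submodule ℝ X) : Prop :=
  ∀ T : Y →L[ℝ] CZero, ∃ T' : X →L[ℝ] CZero, ∀ y : Y, T' (y : X) = T y

variable (X)

/-- `X` has the `c₀`-extension property if every closed subspace of `X` has the
`c₀`-extension property in `X`. -/
def HasCZeroExtensionProperty : Prop :=
  ∀ Y : Submodule ℝ X, IsClosed (Y : Set X) → Y.HasCZeroExtensionIn

/-- `X` has the separable `c₀`-extension property if every separable closed subspace of `X` has the
`c₀`-extension property in `X`. -/
def HasSeparableCZeroExtensionProperty : Prop :=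
  ∀ Y : Submodule ℝ X, IsClosed (Y : Set X) → TopologicalSpace.SeparableSpace Y →
    Y.HasCZeroExtensionIn

/-- `X` has the Sobczyk property if every isomorphic copy of `c₀` in `X` is complemented, that is,
it is the range of a bounded projection of `X`. -/
def HasSobczykProperty : Prop :=
  ∀ Y : Submodule ℝ X, IsClosed (Y : Set X) → Nonempty (Y ≃L[ℝ] CZero) → Y.ClosedComplemented

end ExtensionProperties

/-- The double arrow space `[0,1] × {0,1}`, with the lexicographic order and the order topology. -/
abbrev DoubleArrow : Type := unitInterval ×ₗ Fin 2

namespace DoubleArrow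

instance : TopologicalSpace DoubleArrow := Preorder.topology DoubleArrow

instance : OrderTopology DoubleArrow := ⟨rfl⟩

theorem exists_isLUB (s : Set DoubleArrow) : ∃ x, IsLUB s x := by
  let f : DoubleArrow → unitInterval := fun x => (ofLex x).1
  have le_iff (x y : DoubleArrow) : x ≤ y ↔
      f x < f y ∨ f x = f y ∧ (ofLex x).2 ≤ (ofLex y).2 := Prod.Lex.le_iff
  obtain ⟨a, ha⟩ : ∃ a, IsLUB (f '' s) a := by
    rcases s.eq_empty_or_nonempty with rfl | hs
    · exact ⟨⊥, by simp⟩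
    · refine ⟨sSup (f '' s), isLUB_csSup (hs.image f) ⟨⊤, fun _ _ => le_top⟩⟩
  by_cases h : ∃ x ∈ s, f x = a ∧ (ofLex x).2 = 1
  · obtain ⟨x, hx, hxa, hx1⟩ := h
    refine ⟨x, fun y hy => ?_, fun y hy => hy hx⟩
    rw [le_iff]
    rcases (ha.1 ⟨y, hy, rfl⟩ : f y ≤ a).lt_or_eq with h | h
    · exact Or.inl (hxa ▸ h)
    · exact Or.inr ⟨h.trans hxa.symm, hx1 ▸ Fin.le_last _⟩
  · push Not at h
    refine ⟨toLex (a, 0), fun y hy => ?_, fun y hy => ?_⟩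
    · rw [le_iff]
      rcases (ha.1 ⟨y, hy, rfl⟩ : f y ≤ a).lt_or_eq with h' | h'
      · exact Or.inl h'
      · refine Or.inr ⟨h', ?_⟩
        have := h y hy h'
        change (ofLex y).2 ≤ 0
        generalize (ofLex y).2 = i at *
        fin_cases i <;> simp_all
    · rw [le_iff]
      have : a ≤ f y := ha.2 (by
        rintro _ ⟨z, hz, rfl⟩
        rcases (le_iff z y).1 (hy hz) with h | h
        · exact h.le
        · exact h.1.le)
      rcases this.lt_or_eq with h' | h'
      · exact Or.inl h'
      · exact Or.inr ⟨h', Fin.zero_le _⟩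

instance : CompactSpace DoubleArrow := by
  choose S hS using exists_isLUB
  let : SupSet DoubleArrow := ⟨S⟩
  let C : CompleteLattice DoubleArrow :=
    { (inferInstance : Lattice DoubleArrow), (inferInstance : BoundedOrder DoubleArrow) with
      sSup := S
      sInf := fun s => S (lowerBounds s)
      isLUB_sSup := hS
      isGLB_sInf := fun s => isLUB_lowerBounds.mp (hS _) }
  let : CompleteLinearOrder DoubleArrow :=
    { C, (inferInstance : LinearOrder DoubleArrow),
      LinearOrder.toBiheytingAlgebra DoubleArrow with }
  exact compactSpace_of_completeLinearOrder

end DoubleArrow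

/-! An operator into `c₀` is a bounded pointwise null sequence of functionals; to extend it is to
extend each coordinate and keep the sequence null.

If K is monolithic: a functional on C(K) is carried by the closure of a countable set, the points
where its variation function crosses a rational level (`exists_countable_forall_apply_eq_zero`). All
coordinates of an operator thus live on one separable closed S. As S is metrizable, C(S) is
separable and Sobczyk's theorem applies (`exists_pointwise_null_extension`).

Conversely, an increasing h : K → [0,1] that separates a countable dense part of a closed set S has
finite fibres in S. If such h have only countably many nontrivial fibres, countably many further
functions separate S, which is then metrizable. If some h has uncountably many, let Y be the closure
of {g ∘ h}. Differences of evaluations at the ends of a typewriter sequence of intervals are null on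
Y. A functional vanishing on Y sees only countably many of the step functions cutting the fibres, so
any extension of the differences still takes the value 1 infinitely often at some step function. The
projection of the double arrow space is such an h.

For the Sobczyk property of C(D), let e_m be the unit vectors of c₀ and L an embedding. The sets
where tails of ∑|L e_m| exceed ε are open and decrease to ∅. Functions constant on intervals inside
them form subspaces W_k with dense union, since any two points of D are separated by a jump. Modulo
W_k, the range of L is controlled by finitely many coordinates, so compactness
(`eventually_abs_le_norm_sub`) yields an approximate extension, and a Neumann series turns it into a
projection. -/

open Filter Set

/-! ### Null sequences of functionals and Sobczyk's theorem -/

section FunctionalAnalysis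

theorem exists_tendsto_atTop_eventually_of_forall_eventually {P : ℕ → ℕ → Prop}
    (h : ∀ k, ∀ᶠ n in atTop, P k n) :
    ∃ κ : ℕ → ℕ, Tendsto κ atTop atTop ∧ ∀ᶠ n in atTop, P (κ n) n := by
  simp only [eventually_atTop] at h
  choose N hN using h
  refine ⟨fun n => Nat.findGreatest (fun k => N k ≤ n) n, ?_, ?_⟩
  · refine tendsto_atTop.2 fun b => ?_
    filter_upwards [eventually_ge_atTop (max b (N b))] with n hn
    exact Nat.le_findGreatest (le_of_max_le_left hn) (le_of_max_le_right hn)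
  · filter_upwards [eventually_ge_atTop (N 0)] with n hn
    exact hN _ _ (Nat.findGreatest_spec (P := fun k => N k ≤ n) (Nat.zero_le n) hn)

variable {X : Type*} [NormedAddCommGroup X] [NormedSpace ℝ X]

theorem CZero.abs_apply_le (a : CZero) (n : ℕ) : |a n| ≤ ‖a‖ :=
  BoundedContinuousFunction.norm_coe_le_norm a.toBCF n

theorem CZero.norm_le {a : CZero} {C : ℝ} (hC : 0 ≤ C) (h : ∀ n, |a n| ≤ C) : ‖a‖ ≤ C :=
  (BoundedContinuousFunction.norm_le hC).2 h

theorem CZero.tendsto (a : CZero) : Tendsto a atTop (𝓝 0) := by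
  have := a.zero_at_infty'
  rwa [cocompact_eq_cofinite, Nat.cofinite_eq_atTop] at this

/-- The sequence tending to zero `a`, as an element of `c₀`. -/
def CZero.mk (a : ℕ → ℝ) (h : Tendsto a atTop (𝓝 0)) : CZero where
  toFun := a
  continuous_toFun := continuous_of_discreteTopology
  zero_at_infty' := by rwa [cocompact_eq_cofinite, Nat.cofinite_eq_atTop]

@[simp] theorem CZero.mk_apply (a : ℕ → ℝ) (h : Tendsto a atTop (𝓝 0)) (n : ℕ) :
    CZero.mk a h n = a n := rfl

/-- The coordinate functionals on `c₀`. -/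
noncomputable def CZero.coord (n : ℕ) : CZero →L[ℝ] ℝ :=
  LinearMap.mkContinuous
    { toFun := fun a => a n
      map_add' := fun _ _ => rfl
      map_smul' := fun _ _ => rfl } 1 (fun a => by simpa using CZero.abs_apply_le a n)

@[simp] theorem CZero.coord_apply (n : ℕ) (a : CZero) : CZero.coord n a = a n := rfl

theorem CZero.norm_coord_le (n : ℕ) : ‖CZero.coord n‖ ≤ 1 :=
  LinearMap.mkContinuous_norm_le _ zero_le_one _

theorem CZero.norm_coord_comp_le (T : X →L[ℝ] CZero) (n : ℕ) : ‖(CZero.coord n).comp T‖ ≤ ‖T‖ := by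
  refine (ContinuousLinearMap.opNorm_comp_le _ _).trans ?_
  have := CZero.norm_coord_le n
  nlinarith [norm_nonneg T]

/-- A bounded weak*-null sequence of functionals defines an operator into `c₀`. -/
theorem exists_continuousLinearMap_cZero (ψ : ℕ → X →L[ℝ] ℝ) {C : ℝ} (hC : ∀ n, ‖ψ n‖ ≤ C)
    (h : ∀ x, Tendsto (fun n => ψ n x) atTop (𝓝 0)) :
    ∃ R : X →L[ℝ] CZero, ∀ x n, R x n = ψ n x := by
  have hC0 : 0 ≤ C := (norm_nonneg _).trans (hC 0)
  refine ⟨LinearMap.mkContinuous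
    { toFun := fun x => CZero.mk (fun n => ψ n x) (h x)
      map_add' := fun x y => by ext n; simp
      map_smul' := fun c x => by ext n; simp } C fun x => ?_, fun x n => rfl⟩
  refine CZero.norm_le (by positivity) fun n => ?_
  exact (ψ n).le_of_opNorm_le (hC n) x

theorem tendsto_zero_of_forall_mem_closure {ψ : ℕ → X →L[ℝ] ℝ} {C : ℝ} (hC : ∀ n, ‖ψ n‖ ≤ C)
    {s : Set X} (h : ∀ x ∈ s, Tendsto (fun n => ψ n x) atTop (𝓝 0)) {x : X} (hx : x ∈ closure s) :
    Tendsto (fun n => ψ n x) atTop (𝓝 0) := by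
  have hC0 : 0 ≤ C := (norm_nonneg _).trans (hC 0)
  rw [Metric.tendsto_atTop]
  intro ε hε
  obtain ⟨y, hy, hxy⟩ := Metric.mem_closure_iff.1 hx (ε / (2 * (C + 1))) (by positivity)
  obtain ⟨N, hN⟩ := Metric.tendsto_atTop.1 (h y hy) (ε / 2) (by positivity)
  refine ⟨N, fun n hn => ?_⟩
  have h1 := hN n hn
  have h2 := (ψ n).le_of_opNorm_le (hC n) (x - y)
  rw [Real.dist_0_eq_abs] at *
  rw [dist_eq_norm, lt_div_iff₀ (by positivity)] at hxy
  rw [map_sub, Real.norm_eq_abs] at h2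
  have h3 := abs_sub_abs_le_abs_sub (ψ n x) (ψ n y)
  nlinarith [norm_nonneg (x - y)]

/-- Hahn–Banach on X × X: on pairs (x, y) with y ∈ Y and y - x ∈ W, the functional (x, y) ↦ e y is
dominated by C‖x‖ + η‖y‖. In an extension, the first component is γ and the second is its error on
Y. -/
theorem exists_dual_of_le_dist {Y W : Submodule ℝ X} (e : X →L[ℝ] ℝ) {C η : ℝ} (hC : 0 ≤ C)
    (hη : 0 ≤ η) (h : ∀ y ∈ Y, ∀ w ∈ W, |e y| ≤ C * ‖y - w‖ + η * ‖y‖) :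
    ∃ γ : X →L[ℝ] ℝ, ‖γ‖ ≤ C ∧ (∀ w ∈ W, γ w = 0) ∧ ∀ y ∈ Y, |γ y - e y| ≤ η * ‖y‖ := by
  let V : Submodule ℝ (X × X) := Y.comap (LinearMap.snd ℝ X X) ⊓
    W.comap (LinearMap.snd ℝ X X - LinearMap.fst ℝ X X)
  obtain ⟨G, hG, hG'⟩ := exists_extension_of_le_sublinear
    ⟨V, ((e : X →ₗ[ℝ] ℝ) ∘ₗ LinearMap.snd ℝ X X) ∘ₗ V.subtype⟩
    (fun p => C * ‖p.1‖ + η * ‖p.2‖)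
    (fun c hc x => by
      simp only [Prod.smul_fst, Prod.smul_snd, norm_smul, Real.norm_of_nonneg hc.le]; ring)
    (fun x y => by
      have h1 := norm_add_le x.1 y.1
      have h2 := norm_add_le x.2 y.2
      simp only [Prod.fst_add, Prod.snd_add]
      nlinarith)
    (fun ⟨⟨x, y⟩, hxy⟩ => by
      have hy : y ∈ Y := hxy.1
      have hw : y - x ∈ W := hxy.2
      have := h y hy _ hw
      rw [sub_sub_cancel] at this
      exact (le_abs_self _).trans this)
  replace hG : ∀ x y, y ∈ Y → y - x ∈ W → G (x, y) = e y := fun x y hy hw =>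
    hG ⟨(x, y), ⟨hy, hw⟩⟩
  have habs : ∀ p, |G p| ≤ C * ‖p.1‖ + η * ‖p.2‖ := fun p => by
    refine abs_le.2 ⟨?_, hG' p⟩
    have := hG' (-p)
    simp only [map_neg, Prod.fst_neg, Prod.snd_neg, norm_neg] at this
    linarith
  refine ⟨LinearMap.mkContinuous (G ∘ₗ LinearMap.inl ℝ X X) C fun x => ?_,
    LinearMap.mkContinuous_norm_le _ hC _, fun w hw => ?_, fun y hy => ?_⟩
  · simpa using habs (x, 0)
  · have := hG w 0 Y.zero_mem (by simpa using hw)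
    simpa using this
  · have h1 := hG y y hy (by simp)
    have h2 := habs (0, y)
    have h3 : G (y, y) = G (y, 0) + G (0, y) := by rw [← map_add]; simp
    have h4 : G (y, 0) - e y = - G (0, y) := by linarith
    change |G (y, 0) - e y| ≤ _
    rw [h4, abs_neg]
    simpa using h2

/-- Otherwise bad y_j, w_j exist for infinitely many n. Along a subsequence `hcomp` bounds ‖y_j -
y_i‖, while the functionals tend to 0 at a fixed y_i, so they are too small at y_j. The factor 2
counts the two distances in `hcomp`, which become nearly equal. -/
theorem eventually_abs_le_norm_sub {Y W : Submodule ℝ X} {ψ : ℕ → X →L[ℝ] ℝ} {C A ε η : ℝ}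
    (hC0 : 0 < C) (hC : ∀ n, ‖ψ n‖ ≤ C)
    (hψ : ∀ y ∈ Y, Tendsto (fun n => ψ n y) atTop (𝓝 0)) (hA : 1 ≤ A) (hη : 0 ≤ η)
    (hεη : C * ε < η)
    (hcomp : ∀ y w : ℕ → X, (∀ j, y j ∈ Y) → (∀ j, ‖y j‖ ≤ 1) → (∀ j, w j ∈ W) →
      (∀ j, ‖w j‖ ≤ 2) → ∃ φ : ℕ → ℕ, StrictMono φ ∧ ∀ i j, ‖y (φ i) - y (φ j)‖ ≤
        A * (‖y (φ i) - w (φ i)‖ + ‖y (φ j) - w (φ j)‖) + ε) :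
    ∀ᶠ n in atTop, ∀ y ∈ Y, ∀ w ∈ W, |ψ n y| ≤ 2 * C * A * ‖y - w‖ + η * ‖y‖ := by
  by_contra hcon
  rw [not_eventually] at hcon
  obtain ⟨ν, hν, hbad⟩ := extraction_of_frequently_atTop hcon
  -- With ‖y‖ = 1, the bound |ψ y| ≤ C forces ‖y - w‖ ≤ 1/2, hence ‖w‖ ≤ 2.
  have hbad' : ∀ j, ∃ y ∈ Y, ∃ w ∈ W, ‖y‖ ≤ 1 ∧ ‖w‖ ≤ 2 ∧ ‖y - w‖ ≤ 1 / 2 ∧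
      2 * C * A * ‖y - w‖ + η < |ψ (ν j) y| := by
    intro j
    have := hbad j
    push Not at this
    obtain ⟨y, hy, w, hw, hyw⟩ := this
    have hy0 : 0 < ‖y‖ := by
      rw [norm_pos_iff]
      rintro rfl
      rw [map_zero, abs_zero] at hyw
      have : 0 ≤ 2 * C * A * ‖0 - w‖ + η * ‖(0 : X)‖ := by positivity
      linarith
    have h1 : ‖‖y‖⁻¹ • y‖ = 1 := by
      rw [norm_smul, norm_inv, norm_norm, inv_mul_cancel₀ hy0.ne']
    have h2 : 2 * C * A * ‖‖y‖⁻¹ • y - ‖y‖⁻¹ • w‖ + η < |ψ (ν j) (‖y‖⁻¹ • y)| := by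
      rw [← smul_sub, norm_smul, norm_inv, norm_norm, map_smul, smul_eq_mul, abs_mul, abs_inv,
        abs_norm]
      rw [← mul_lt_mul_iff_right₀ (inv_pos.2 hy0)] at hyw
      have h0 := inv_mul_cancel₀ hy0.ne'
      linear_combination hyw - η * h0
    have h3 : |ψ (ν j) (‖y‖⁻¹ • y)| ≤ C := by
      have := (ψ (ν j)).le_of_opNorm_le (hC _) (‖y‖⁻¹ • y)
      rwa [h1, mul_one] at this
    have h4 : ‖‖y‖⁻¹ • y - ‖y‖⁻¹ • w‖ ≤ 1 / 2 := by
      by_contra! h5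
      have : C < 2 * C * ‖‖y‖⁻¹ • y - ‖y‖⁻¹ • w‖ := by nlinarith
      have : 2 * C * ‖‖y‖⁻¹ • y - ‖y‖⁻¹ • w‖ ≤ 2 * C * A * ‖‖y‖⁻¹ • y - ‖y‖⁻¹ • w‖ := by
        refine mul_le_mul_of_nonneg_right ?_ (norm_nonneg _)
        nlinarith
      linarith
    refine ⟨_, Y.smul_mem ‖y‖⁻¹ hy, _, W.smul_mem ‖y‖⁻¹ hw, h1.le, ?_, h4, h2⟩
    have := norm_sub_norm_le (‖y‖⁻¹ • w) (‖y‖⁻¹ • y)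
    rw [norm_sub_rev] at this
    linarith
  choose y hy w hw hy1 hw2 hr hbig using hbad'
  obtain ⟨φ, hφ, hφ'⟩ := hcomp y w hy hy1 hw hw2
  obtain ⟨r, -, χ, hχ, hr'⟩ := tendsto_subseq_of_bounded (Metric.isBounded_Icc (0 : ℝ) (1 / 2))
    (x := fun j => ‖y (φ j) - w (φ j)‖) (fun j => ⟨norm_nonneg _, hr _⟩)
  -- Nullity at y_i costs s and exchanging the two distances costs 2CAs; together they use up the
  -- margin η - Cε.
  set s : ℝ := (η - C * ε) / (1 + 2 * C * A) with hs
  have hs0 : 0 < s := div_pos (by linarith) (by positivity)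
  have hev := Metric.tendsto_nhds.1 hr' s hs0
  obtain ⟨i, hi⟩ := hev.exists
  have hnull := ((hψ _ (hy (φ (χ i)))).comp (hν.comp (hφ.comp hχ)).tendsto_atTop)
  obtain ⟨j, hj, hj'⟩ := (hev.and (Metric.tendsto_nhds.1 hnull s hs0)).exists
  simp only [Function.comp, Real.dist_eq, sub_zero] at hi hj hj'
  have h1 := hbig (φ (χ j))
  have h2 := (ψ (ν (φ (χ j)))).le_of_opNorm_le (hC _) (y (φ (χ j)) - y (φ (χ i)))
  rw [map_sub, Real.norm_eq_abs] at h2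
  have h3 := abs_sub_abs_le_abs_sub (ψ (ν (φ (χ j))) (y (φ (χ j)))) (ψ (ν (φ (χ j))) (y (φ (χ i))))
  have h4 := hφ' (χ j) (χ i)
  have h5 := mul_le_mul_of_nonneg_left h4 hC0.le
  have h6 : s * (1 + 2 * C * A) = η - C * ε := div_mul_cancel₀ _ (by positivity)
  have h7 : ‖y (φ (χ i)) - w (φ (χ i))‖ ≤ ‖y (φ (χ j)) - w (φ (χ j))‖ + 2 * s := by
    have := abs_lt.1 hi
    have := abs_lt.1 hj
    linarith
  have h8 := mul_le_mul_of_nonneg_left h7 (by positivity : 0 ≤ C * A)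
  nlinarith

/-- Sobczyk's theorem for functionals: on a separable space, a bounded sequence of functionals
which is pointwise null on a subspace can be changed off that subspace into a bounded pointwise
null sequence. -/
theorem exists_pointwise_null_extension [TopologicalSpace.SeparableSpace X] {Y : Submodule ℝ X}
    {ψ : ℕ → X →L[ℝ] ℝ} {C : ℝ} (hC : ∀ n, ‖ψ n‖ ≤ C)
    (hψ : ∀ y ∈ Y, Tendsto (fun n => ψ n y) atTop (𝓝 0)) :
    ∃ ρ : ℕ → X →L[ℝ] ℝ, (∃ C', ∀ n, ‖ρ n‖ ≤ C') ∧ (∀ n, ∀ y ∈ Y, ρ n y = ψ n y) ∧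
      ∀ x, Tendsto (fun n => ρ n x) atTop (𝓝 0) := by
  wlog hC0 : 0 < C generalizing C
  · exact this (C := max C 1) (fun n => (hC n).trans (le_max_left _ _)) (by positivity)
  let u := TopologicalSpace.denseSeq X
  let W : ℕ → Submodule ℝ X := fun k => Submodule.span ℝ (u '' Iio k)
  have hfin : ∀ k, FiniteDimensional ℝ (W k) := fun k =>
    FiniteDimensional.span_of_finite ℝ ((finite_Iio k).image u)
  have key : ∀ k : ℕ, ∀ᶠ n in atTop, ∃ ρ : X →L[ℝ] ℝ, ‖ρ‖ ≤ 2 * C + 1 ∧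
      (∀ y ∈ Y, ρ y = ψ n y) ∧ ∀ w ∈ W k, |ρ w| ≤ 1 / ((k : ℝ) + 1) * ‖w‖ := by
    intro k
    have hη : 0 < 1 / ((k : ℝ) + 1) := by positivity
    have hη1 : 1 / ((k : ℝ) + 1) ≤ 1 := by
      rw [div_le_one (by positivity)]; simp
    have := eventually_abs_le_norm_sub (W := W k) (A := 1)
      (ε := 1 / ((k : ℝ) + 1) / (2 * C)) hC0 hC hψ le_rfl hη.le (by field_simp; norm_num) ?_
    · filter_upwards [this] with n hn
      obtain ⟨γ, hγ, hγW, hγY⟩ := exists_dual_of_le_dist (ψ n) (by positivity) hη.le hn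
      -- Extending the error on Y with the same norm and adding it back makes agreement on Y exact,
      -- at a cost of 1/(k+1) on W k.
      let β : Y →L[ℝ] ℝ := LinearMap.mkContinuous
        (((ψ n - γ : X →L[ℝ] ℝ) : X →ₗ[ℝ] ℝ) ∘ₗ Y.subtype) (1 / ((k : ℝ) + 1)) (fun y => by
          have := hγY y y.2
          rw [abs_sub_comm] at this
          simpa using this)
      obtain ⟨β', hβ', hβn⟩ := _root_.exists_extension_norm_eq Y β
      have hβk : ‖β'‖ ≤ 1 / ((k : ℝ) + 1) :=
        hβn.trans_le (LinearMap.mkContinuous_norm_le _ hη.le _)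
      refine ⟨γ + β', (norm_add_le _ _).trans (by linarith), fun y hy => ?_, fun w hw => ?_⟩
      · have := hβ' ⟨y, hy⟩
        simp only [_root_.add_apply, this]
        simp [β]
      · have := β'.le_of_opNorm_le hβk w
        simpa [hγW w hw] using this
    · intro y w hy hy1 hw hw2
      have := FiniteDimensional.proper_real (W k)
      obtain ⟨a, -, φ, hφ, ha⟩ := tendsto_subseq_of_bounded
        (Metric.isBounded_closedBall (x := (0 : W k)) (r := 2)) (x := fun j => ⟨w j, hw j⟩)
        (fun j => by simpa using hw2 j)
      have hε : 0 < 1 / ((k : ℝ) + 1) / (2 * C) := by positivity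
      obtain ⟨N, hN⟩ := Metric.cauchySeq_iff.1 ha.cauchySeq _ hε
      refine ⟨fun j => φ (N + j), hφ.comp fun i j h => by simpa using h, fun i j => ?_⟩
      have h1 : ‖w (φ (N + i)) - w (φ (N + j))‖ < 1 / ((k : ℝ) + 1) / (2 * C) := by
        have := hN (N + i) (by simp) (N + j) (by simp)
        rwa [dist_eq_norm] at this
      have h2 : y (φ (N + i)) - y (φ (N + j)) = (y (φ (N + i)) - w (φ (N + i))) -
        (y (φ (N + j)) - w (φ (N + j))) + (w (φ (N + i)) - w (φ (N + j))) := by abel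
      rw [h2]
      refine (norm_add_le _ _).trans (add_le_add ((norm_sub_le _ _).trans ?_) h1.le)
      rw [one_mul]
  obtain ⟨κ, hκ, hev⟩ := exists_tendsto_atTop_eventually_of_forall_eventually key
  -- For the finitely many n not covered by `hev`, ψ n itself may be the value.
  have hall : ∀ n, ∃ ρ : X →L[ℝ] ℝ, ‖ρ‖ ≤ 2 * C + 1 ∧ (∀ y ∈ Y, ρ y = ψ n y) ∧
      ((∃ ρ : X →L[ℝ] ℝ, ‖ρ‖ ≤ 2 * C + 1 ∧ (∀ y ∈ Y, ρ y = ψ n y) ∧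
        ∀ w ∈ W (κ n), |ρ w| ≤ 1 / ((κ n : ℝ) + 1) * ‖w‖) →
      ∀ w ∈ W (κ n), |ρ w| ≤ 1 / ((κ n : ℝ) + 1) * ‖w‖) := fun n => by
    by_cases h : ∃ ρ : X →L[ℝ] ℝ, ‖ρ‖ ≤ 2 * C + 1 ∧ (∀ y ∈ Y, ρ y = ψ n y) ∧
        ∀ w ∈ W (κ n), |ρ w| ≤ 1 / ((κ n : ℝ) + 1) * ‖w‖
    · obtain ⟨ρ, h1, h2, h3⟩ := h
      exact ⟨ρ, h1, h2, fun _ => h3⟩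
    · exact ⟨ψ n, (hC n).trans (by linarith), fun _ _ => rfl, fun h' => absurd h' h⟩
  choose ρ hρ hρY hρW using hall
  refine ⟨ρ, ⟨_, hρ⟩, hρY, fun x => ?_⟩
  refine tendsto_zero_of_forall_mem_closure hρ (s := range u) ?_ (TopologicalSpace.denseRange_denseSeq X x)
  rintro _ ⟨i, rfl⟩
  have hlim : Tendsto (fun n => 1 / ((κ n : ℝ) + 1) * ‖u i‖) atTop (𝓝 0) := by
    simpa using ((tendsto_one_div_add_atTop_nhds_zero_nat (𝕜 := ℝ)).comp hκ).mul_const ‖u i‖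
  refine squeeze_zero_norm' ?_ hlim
  filter_upwards [hev, hκ.eventually_gt_atTop i] with n h1 h2
  exact hρW n h1 _ (Submodule.subset_span ⟨i, h2, rfl⟩)

end FunctionalAnalysis

/-! ### Supports of functionals; monolithic lines -/

section CompactLine

variable {K : Type*} [LinearOrder K] [TopologicalSpace K] [OrderTopology K] [CompactSpace K]

/-- W t is the variation of φ on (-∞, t). If φ h > 0, adding h/‖h‖ to competitors for W c shows that
W t exceeds W c by a fixed amount for all t > d. A rational p in this gap puts the top of the
closure of {W < p} into [c, d]. -/
theorem apply_eq_zero_of_forall_notMem_Icc (φ : C(K, ℝ) →L[ℝ] ℝ) {W : K → ℝ}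
    (hW : ∀ t, IsLUB (φ '' {h | ‖h‖ ≤ 1 ∧ ∀ x, t ≤ x → h x = 0}) (W t)) {c d : K}
    (hcd : ∀ (p : ℚ) (q : K), IsGreatest (closure {t | W t < p}) q → q ∉ Icc c d) {h : C(K, ℝ)}
    (hh : ∀ x, x ∉ Icc c d → h x = 0) : φ h = 0 := by
  suffices H : ∀ h : C(K, ℝ), (∀ x, x ∉ Icc c d → h x = 0) → φ h ≤ 0 by
    refine le_antisymm (H h hh) ?_
    have := H (-h) (fun x hx => by simp [hh x hx])
    rw [map_neg] at this
    linarith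
  clear hh h
  intro h hh
  by_contra! hpos
  have h0 : 0 < ‖h‖ := by
    rw [norm_pos_iff]
    rintro rfl
    simp at hpos
  set v := φ (‖h‖⁻¹ • h) with hv
  have hvpos : 0 < v := by
    rw [hv, map_smul, smul_eq_mul]
    positivity
  obtain ⟨p, hp1, hp2⟩ := exists_rat_btwn (lt_add_of_pos_right (W c) hvpos)
  have hne : {t | W t < p}.Nonempty := ⟨c, hp1⟩
  obtain ⟨q, hq⟩ := (isClosed_closure (s := {t | W t < p})).isCompact.exists_isGreatest hne.closure
  refine hcd p q hq ⟨hq.2 (subset_closure hp1), ?_⟩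
  refine closure_minimal (t := Iic d) (fun t ht => ?_) isClosed_Iic hq.1
  by_contra! htd
  rw [mem_Iic, not_le] at htd
  have : W c ≤ W t - v := by
    refine (hW c).2 ?_
    rintro _ ⟨g, ⟨hg1, hg2⟩, rfl⟩
    rw [le_sub_iff_add_le]
    refine (hW t).1 ⟨g + ‖h‖⁻¹ • h, ⟨?_, fun x hx => ?_⟩, by rw [map_add]⟩
    · rw [ContinuousMap.norm_le _ zero_le_one]
      intro x
      by_cases hx : c ≤ x
      · have := ContinuousMap.norm_coe_le_norm h x
        rw [ContinuousMap.add_apply, hg2 x hx, zero_add, ContinuousMap.smul_apply, norm_smul,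
          norm_inv, norm_norm, inv_mul_le_iff₀ h0, mul_one]
        exact this
      · rw [ContinuousMap.add_apply, ContinuousMap.smul_apply, hh x (fun h' => hx h'.1), smul_zero,
          add_zero]
        exact (ContinuousMap.norm_coe_le_norm g x).trans hg1
    · rw [ContinuousMap.add_apply, ContinuousMap.smul_apply, hh x, smul_zero, add_zero]
      · rcases le_total c x with hcx | hcx
        · exact hg2 x hcx
        · by_contra hgx
          have hd : ¬ c ≤ d := fun hcd' => (htd.trans_le hx).not_ge (hcx.trans hcd')
          refine hpos.ne' ?_
          have : h = 0 := by
            ext x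
            exact hh x (fun h' => hd (h'.1.trans h'.2))
          rw [this, map_zero]
      · exact fun h' => (htd.trans_le hx).not_ge h'.2
  have : W t < p := ht
  linarith

/-- Functionals on `C(K)`, for `K` a compact line, are carried by separable subsets. -/
theorem exists_countable_forall_apply_eq_zero (φ : C(K, ℝ) →L[ℝ] ℝ) :
    ∃ Q : Set K, Q.Countable ∧ ∀ f : C(K, ℝ), (∀ q ∈ Q, f q = 0) → φ f = 0 := by
  have hW : ∀ t, ∃ w, IsLUB (φ '' {h | ‖h‖ ≤ 1 ∧ ∀ x, t ≤ x → h x = 0}) w := fun t => by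
    refine Real.exists_isLUB ⟨_, 0, ⟨by simp, by simp⟩, rfl⟩ ⟨‖φ‖, ?_⟩
    rintro _ ⟨h, ⟨hh, -⟩, rfl⟩
    exact (le_abs_self _).trans (φ.unit_le_opNorm h hh)
  choose W hW using hW
  refine ⟨⋃ p : ℚ, {q | IsGreatest (closure {t | W t < p}) q},
    countable_iUnion fun p => Set.Subsingleton.countable fun a ha b hb => ha.unique hb,
    fun f hf => ?_⟩
  set Q := ⋃ p : ℚ, {q | IsGreatest (closure {t | W t < p}) q} with hQ
  have hcl : ∀ x ∈ closure Q, f x = 0 := fun x hx =>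
    closure_minimal (t := f ⁻¹' {0}) hf (isClosed_singleton.preimage f.continuous) hx
  suffices H : ∀ ε > 0, |φ f| ≤ ‖φ‖ * ε by
    by_contra hne
    have h1 : 0 < |φ f| := abs_pos.2 hne
    have h2 := H (|φ f| / (2 * (‖φ‖ + 1))) (by positivity)
    have h3 : ‖φ‖ * (|φ f| / (2 * (‖φ‖ + 1))) < |φ f| := by
      rw [mul_div_assoc', div_lt_iff₀ (by positivity)]
      nlinarith [norm_nonneg φ]
    linarith
  intro ε hε
  -- Truncation: g is within ε of f and its nonzero set lies in a compact set avoiding the closure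
  -- of Q.
  let g : C(K, ℝ) := ⟨fun x => f x - max (-ε) (min ε (f x)), by fun_prop⟩
  have hfg : ‖f - g‖ ≤ ε := by
    rw [ContinuousMap.norm_le _ hε.le]
    intro x
    rw [Real.norm_eq_abs, abs_le]
    simp only [g, ContinuousMap.sub_apply, ContinuousMap.coe_mk, sub_sub_cancel]
    exact ⟨le_max_left _ _, max_le (by linarith) (min_le_left _ _)⟩
  have hg0 : ∀ x, |f x| < ε → g x = 0 := fun x hx => by
    obtain ⟨h1, h2⟩ := abs_lt.1 hx
    simp only [g, ContinuousMap.coe_mk]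
    rw [min_eq_right h2.le, max_eq_right h1.le, sub_self]
  have hC : IsCompact {x | ε ≤ |f x|} :=
    (isClosed_le continuous_const (by fun_prop)).isCompact
  -- Order components are convex, so the hull [c, d] of the support of each partition function still
  -- misses Q.
  obtain ⟨F, hF, hcov⟩ := hC.elim_nhds_subcover
    (fun x => interior (ordConnectedComponent (closure Q)ᶜ x)) (fun x hx => by
      refine interior_mem_nhds.2 (ordConnectedComponent_mem_nhds.2 ?_)
      refine isClosed_closure.isOpen_compl.mem_nhds fun hx' => ?_
      rw [Set.mem_ofPred_eq, hcl x hx', abs_zero] at hx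
      linarith)
  obtain ⟨ρ, hρ, hρ1, -, -⟩ := exists_continuous_sum_one_of_isOpen_isCompact
    (s := fun i : Fin F.card =>
      interior (ordConnectedComponent (closure Q)ᶜ ((F.equivFin.symm i : F) : K)))
    (fun i => isOpen_interior) hC (fun x hx => by
      obtain ⟨y, hy, hxy⟩ := mem_iUnion₂.1 (hcov hx)
      refine mem_iUnion.2 ⟨F.equivFin ⟨y, hy⟩, ?_⟩
      simpa using hxy)
  have hsum : g = ∑ i, ρ i * g := by
    rw [← Finset.sum_mul]
    ext x
    rw [ContinuousMap.mul_apply]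
    by_cases hx : ε ≤ |f x|
    · have := hρ1 hx
      simp only [Finset.sum_apply, Pi.one_apply] at this
      rw [ContinuousMap.sum_apply, this, one_mul]
    · rw [hg0 x (not_le.1 hx), mul_zero]
  have hφg : φ g = 0 := by
    rw [hsum, map_sum]
    refine Finset.sum_eq_zero fun i _ => ?_
    rcases (tsupport (ρ i)).eq_empty_or_nonempty with h | h
    · rw [tsupport_eq_empty_iff] at h
      have : ρ i = 0 := DFunLike.coe_injective h
      rw [this, zero_mul, map_zero]
    · have hcpt : IsCompact (tsupport (ρ i)) := (isClosed_tsupport _).isCompact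
      obtain ⟨c, hc⟩ := hcpt.exists_isLeast h
      obtain ⟨d, hd⟩ := hcpt.exists_isGreatest h
      refine apply_eq_zero_of_forall_notMem_Icc φ hW (c := c) (d := d) (fun p q hq hqcd => ?_)
        fun x hx => ?_
      · have hmem := (inferInstance : OrdConnected (ordConnectedComponent (closure Q)ᶜ
          ((F.equivFin.symm i : F) : K))).out (interior_subset (hρ i hc.1))
          (interior_subset (hρ i hd.1)) hqcd
        exact ordConnectedComponent_subset hmem (subset_closure (mem_iUnion.2 ⟨p, hq⟩))
      · have : x ∉ tsupport (ρ i) := fun hx' => hx ⟨hc.2 hx', hd.2 hx'⟩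
        rw [ContinuousMap.mul_apply, image_eq_zero_of_notMem_tsupport this, zero_mul]
  have h1 : φ f = φ (f - g) := by rw [map_sub, hφg, sub_zero]
  rw [h1]
  exact (φ.le_opNorm _).trans (mul_le_mul_of_nonneg_left hfg (norm_nonneg _))

theorem separableSpace_closure {Z : Type*} [TopologicalSpace Z] {Q : Set Z} (hQ : Q.Countable) :
    TopologicalSpace.SeparableSpace (closure Q) := by
  refine ⟨⟨(↑) ⁻¹' Q, hQ.preimage Subtype.val_injective, ?_⟩⟩
  rw [Subtype.dense_iff]
  intro x hx
  rwa [Subtype.image_preimage_coe, inter_eq_right.2 subset_closure]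

theorem IsAlephZeroMonolithic.hasCZeroExtensionProperty (hK : IsAlephZeroMonolithic K) :
    HasCZeroExtensionProperty C(K, ℝ) := by
  intro Y _ T
  have hext : ∀ n, ∃ φ : C(K, ℝ) →L[ℝ] ℝ, (∀ y : Y, φ y = T y n) ∧ ‖φ‖ ≤ ‖T‖ := fun n => by
    obtain ⟨φ, h1, h2⟩ := exists_extension_norm_eq Y ((CZero.coord n).comp T)
    exact ⟨φ, h1, h2.trans_le (CZero.norm_coord_comp_le T n)⟩
  choose φ hφ hφn using hext
  choose Q hQ hQφ using fun n => exists_countable_forall_apply_eq_zero (φ n)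
  set S := closure (⋃ n, Q n) with hS
  have := hK S (separableSpace_closure (countable_iUnion hQ))
  let := TopologicalSpace.metrizableSpaceMetric S
  have : CompactSpace S := isCompact_iff_compactSpace.1 isClosed_closure.isCompact
  have hres : ∀ n (f g : C(K, ℝ)), (∀ s ∈ S, f s = g s) → φ n f = φ n g := fun n f g h => by
    rw [← sub_eq_zero, ← map_sub]
    refine hQφ n _ fun q hq => ?_
    rw [ContinuousMap.sub_apply, h q (subset_closure (mem_iUnion.2 ⟨n, hq⟩)), sub_self]
  have htietze : ∀ g : C(S, ℝ), ∃ f : C(K, ℝ), ‖f‖ ≤ ‖g‖ ∧ ∀ s : S, f s = g s := fun g => by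
    obtain ⟨f, hf, hfg⟩ := BoundedContinuousFunction.exists_extension_norm_eq_of_isClosedEmbedding
      (BoundedContinuousFunction.mkOfCompact g) (e := ((↑) : S → K))
      isClosed_closure.isClosedEmbedding_subtypeVal
    refine ⟨f.toContinuousMap, ?_, fun s => congrFun hfg s⟩
    rw [BoundedContinuousFunction.norm_mkOfCompact] at hf
    rw [ContinuousMap.norm_le _ (norm_nonneg _)]
    intro x
    rw [← hf]
    exact f.norm_coe_le_norm x
  choose e he heS using htietze
  -- The choice `e` need not be linear; φ n ∘ e is, because φ n depends only on restrictions to S.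
  let ψ : ℕ → C(S, ℝ) →L[ℝ] ℝ := fun n => LinearMap.mkContinuous
    { toFun := fun g => φ n (e g)
      map_add' := fun f g => by
        rw [← map_add]
        exact hres n _ _ fun s hs => by simp [heS _ ⟨s, hs⟩]
      map_smul' := fun c f => by
        rw [← map_smul]
        exact hres n _ _ fun s hs => by simp [heS _ ⟨s, hs⟩] } ‖T‖
    fun g => ((φ n).le_of_opNorm_le (hφn n) _).trans
      (mul_le_mul_of_nonneg_left (he g) (norm_nonneg T))
  let r : C(K, ℝ) →L[ℝ] C(S, ℝ) := LinearMap.mkContinuous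
    { toFun := fun f => f.restrict S
      map_add' := fun f g => rfl
      map_smul' := fun c f => rfl } 1 fun f => by
    rw [one_mul, ContinuousMap.norm_le _ (norm_nonneg _)]
    exact fun s => f.norm_coe_le_norm s
  have hψr : ∀ n f, ψ n (r f) = φ n f := fun n f =>
    hres n _ _ fun s hs => heS _ ⟨s, hs⟩
  obtain ⟨ρ, ⟨C', hC'⟩, hρY, hρ⟩ := exists_pointwise_null_extension (Y := Y.map (r : C(K, ℝ) →ₗ[ℝ] C(S, ℝ)))
    (ψ := ψ) (C := ‖T‖) (fun n => LinearMap.mkContinuous_norm_le _ (norm_nonneg T) _) (by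
      rintro _ ⟨y, hy, rfl⟩
      refine (CZero.tendsto (T ⟨y, hy⟩)).congr fun n => ?_
      rw [← hφ n ⟨y, hy⟩]
      exact (hψr n y).symm)
  obtain ⟨R, hR⟩ := exists_continuousLinearMap_cZero ρ hC' hρ
  refine ⟨R.comp r, fun y => ?_⟩
  ext n
  rw [ContinuousLinearMap.comp_apply, hR, ← hφ, ← hψr]
  exact hρY n _ ⟨y, y.2, rfl⟩

end CompactLine

/-! ### Uncountably many nontrivial fibres prevent extension -/

theorem Submodule.HasCZeroExtensionIn.exists_forall_apply_eq {X : Type*} [NormedAddCommGroup X]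
    [NormedSpace ℝ X] {Y : Submodule ℝ X} (hY : Y.HasCZeroExtensionIn) {ψ : ℕ → X →L[ℝ] ℝ} {C : ℝ}
    (hC : ∀ n, ‖ψ n‖ ≤ C) (hψ : ∀ y ∈ Y, Tendsto (fun n => ψ n y) atTop (𝓝 0)) :
    ∃ T : X →L[ℝ] CZero, ∀ n, ∀ y ∈ Y, T y n = ψ n y := by
  obtain ⟨T, hT⟩ := exists_continuousLinearMap_cZero (fun n => (ψ n).comp Y.subtypeL) (C := C)
    (fun n => ContinuousLinearMap.opNorm_le_bound _ ((norm_nonneg _).trans (hC 0)) fun y =>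
      (ψ n).le_of_opNorm_le (hC n) (y : X)) (fun y => hψ y y.2)
  obtain ⟨T', hT'⟩ := hY T
  exact ⟨T', fun n y hy => by rw [hT' ⟨y, hy⟩]; exact hT ⟨y, hy⟩ n⟩

/-- Modulo functions g ∘ h, each step function f r can be localised near the fibre over r. Finitely
many localised ones have disjoint supports, so ∑|ν (f r)| ≤ ‖ν‖. -/
theorem countable_apply_ne_zero_of_forall_comp {K : Type*} [LinearOrder K]
    [TopologicalSpace K] [CompactSpace K] (h : C(K, unitInterval)) (hmono : Monotone h)
    {R : Set unitInterval} {t t' : R → K} (ht : ∀ r, h (t r) = r) (ht' : ∀ r, h (t' r) = r)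
    {f : R → C(K, ℝ)} (hf0 : ∀ r x, t' r ≤ x → f r x = 0) (hf1 : ∀ r x, x ≤ t r → f r x = 1)
    (hf : ∀ r x, f r x ∈ Icc (0 : ℝ) 1) (ν : C(K, ℝ) →L[ℝ] ℝ)
    (hν : ∀ g : C(unitInterval, ℝ), ν (g.comp h) = 0) : {r | ν (f r) ≠ 0}.Countable := by
  suffices Summable fun r => |ν (f r)| by
    refine this.countable_support.mono fun r hr => ?_
    simpa using hr
  refine summable_of_sum_le (c := ‖ν‖) (fun r => abs_nonneg _) fun F => ?_
  obtain ⟨δ, hδ, hsep⟩ : ∃ δ > 0, ∀ r ∈ F, ∀ s ∈ F, r ≠ s → 2 * δ ≤ |((r : unitInterval) : ℝ) - s| := by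
    have : ∀ p ∈ F ×ˢ F, ∃ δ > 0, p.1 ≠ p.2 → 2 * δ ≤ |((p.1 : unitInterval) : ℝ) - p.2| := by
      intro p _
      by_cases hp : p.1 = p.2
      · exact ⟨1, one_pos, fun h' => absurd hp h'⟩
      · refine ⟨|((p.1 : unitInterval) : ℝ) - p.2| / 2, ?_, fun _ => by linarith⟩
        have : ((p.1 : unitInterval) : ℝ) - p.2 ≠ 0 := fun h' =>
          hp (Subtype.ext (Subtype.ext (sub_eq_zero.1 h')))
        positivity
    have hev : ∀ᶠ δ in 𝓝[>] (0 : ℝ), ∀ p ∈ F ×ˢ F, p.1 ≠ p.2 →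
        2 * δ ≤ |((p.1 : unitInterval) : ℝ) - p.2| := by
      rw [Filter.eventually_all_finset]
      intro p hp
      obtain ⟨δ, hδ, h1⟩ := this p hp
      filter_upwards [Ioo_mem_nhdsGT hδ] with ε hε hne
      linarith [h1 hne, hε.2]
    obtain ⟨δ, hδ, hδ0⟩ := (hev.and self_mem_nhdsWithin).exists
    exact ⟨δ, hδ0, fun r hr s hs => hδ (r, s) (Finset.mk_mem_product hr hs)⟩
  let g : R → C(unitInterval, ℝ) := fun r =>
    ⟨fun s => max 0 (min 1 ((((r : unitInterval) : ℝ) + δ - s) / (2 * δ))), by fun_prop⟩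
  have hg : ∀ r s, g r s ∈ Icc (0 : ℝ) 1 := fun r s =>
    ⟨le_max_left _ _, max_le zero_le_one (min_le_left _ _)⟩
  have hfg : ∀ (r : R) x, δ ≤ |((r : unitInterval) : ℝ) - h x| → f r x = g r (h x) := by
    intro r x hx
    simp only [g, ContinuousMap.coe_mk]
    rcases le_abs.1 hx with h1 | h1
    · have hlt : x ≤ t r := by
        by_contra! hcon
        have : (h (t r) : ℝ) ≤ h x := hmono hcon.le
        rw [ht] at this
        linarith
      rw [hf1 r x hlt, min_eq_left, max_eq_right zero_le_one]
      rw [one_le_div (by positivity)]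
      linarith
    · have hlt : t' r ≤ x := by
        by_contra! hcon
        have : (h x : ℝ) ≤ h (t' r) := hmono hcon.le
        rw [ht'] at this
        linarith
      rw [hf0 r x hlt, max_eq_left]
      exact (min_le_right _ _).trans (div_nonpos_of_nonpos_of_nonneg (by linarith) (by positivity))
  have hsign : ∀ r, ∃ a : ℝ, |a| ≤ 1 ∧ a * ν (f r) = |ν (f r)| := fun r => by
    rcases abs_choice (ν (f r)) with h1 | h1
    · exact ⟨1, by simp, by rw [one_mul, h1]⟩
    · exact ⟨-1, by simp, by rw [h1]; ring⟩
  choose a ha hasgn using hsign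
  let y : C(K, ℝ) := ∑ r ∈ F, a r • (f r - (g r).comp h)
  have hy : ν y = ∑ r ∈ F, |ν (f r)| := by
    simp only [y, map_sum]
    refine Finset.sum_congr rfl fun r _ => ?_
    rw [map_smul, map_sub, hν, sub_zero, smul_eq_mul, hasgn]
  have hyn : ‖y‖ ≤ 1 := by
    rw [ContinuousMap.norm_le _ zero_le_one]
    intro x
    have hyx : y x = ∑ r ∈ F, a r * (f r x - g r (h x)) := by
      simp [y, ContinuousMap.sum_apply]
    rw [hyx]
    by_cases hex : ∃ r ∈ F, |((r : unitInterval) : ℝ) - h x| < δ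
    · obtain ⟨r, hr, hrx⟩ := hex
      rw [Finset.sum_eq_single_of_mem r hr fun s hs hsr => ?_]
      · rw [Real.norm_eq_abs, abs_mul]
        have h1 := hf r x
        have h2 := hg r (h x)
        exact mul_le_one₀ (ha r) (abs_nonneg _)
          (abs_le.2 ⟨by linarith [h1.1, h2.2], by linarith [h1.2, h2.1]⟩)
      · rw [hfg s x ?_, sub_self, mul_zero]
        have h1 := hsep s hs r hr hsr
        have h2 := abs_sub_le ((s : unitInterval) : ℝ) (h x) r
        rw [abs_sub_comm (h x : ℝ)] at h2
        linarith
    · push Not at hex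
      rw [Finset.sum_eq_zero fun r hr => by rw [hfg r x (hex r hr), sub_self, mul_zero]]
      simp
  rw [← hy]
  exact (le_abs_self _).trans (ν.unit_le_opNorm y hyn)

section CompactLine

variable {K : Type*} [LinearOrder K] [TopologicalSpace K] [OrderTopology K] [CompactSpace K]

/-- The typewriter sequence of intervals, pulled back to a compact line. -/
theorem exists_seq_forall_frequently_mem_Icc [Nonempty K] (h : C(K, unitInterval)) :
    ∃ x z : ℕ → K, Tendsto (fun n => dist (h (x n)) (h (z n))) atTop (𝓝 0) ∧
      ∀ r, ∃ᶠ n in atTop, ∀ t, h t = r → t ∈ Icc (x n) (z n) := by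
  -- Write n = k² + i with k = `n.sqrt` and 0 ≤ i ≤ 2k; n encodes the interval [i/(k+1),
  -- (i+1)/(k+1)].
  have key : ∀ n : ℕ, ∃ x z : K, dist (h x) (h z) ≤ 1 / ((n.sqrt : ℝ) + 1) ∧
      ∀ t, (h t : ℝ) ∈ Icc (((n - n.sqrt * n.sqrt : ℕ) : ℝ) / ((n.sqrt : ℝ) + 1))
        ((((n - n.sqrt * n.sqrt : ℕ) : ℝ) + 1) / ((n.sqrt : ℝ) + 1)) → t ∈ Icc x z := by
    intro n
    generalize ((n - n.sqrt * n.sqrt : ℕ) : ℝ) = i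
    have hk : 0 ≤ 1 / ((n.sqrt : ℝ) + 1) := by positivity
    generalize (n.sqrt : ℝ) + 1 = k at hk ⊢
    set A : Set K := {t | (h t : ℝ) ∈ Icc (i / k) ((i + 1) / k)} with hA
    have hAc : IsCompact A :=
      (isClosed_Icc.preimage (continuous_subtype_val.comp h.continuous)).isCompact
    rcases A.eq_empty_or_nonempty with hAe | hAn
    · obtain ⟨x⟩ := ‹Nonempty K›
      refine ⟨x, x, by simpa using hk, fun t ht => ?_⟩
      have : t ∈ A := ht
      rw [hAe] at this
      exact this.elim
    · obtain ⟨x, hx⟩ := hAc.exists_isLeast hAn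
      obtain ⟨z, hz⟩ := hAc.exists_isGreatest hAn
      refine ⟨x, z, ?_, fun t ht => ⟨hx.2 ht, hz.2 ht⟩⟩
      have := Real.dist_le_of_mem_Icc hx.1 hz.1
      rwa [← sub_div, add_sub_cancel_left] at this
  choose x z hxz hmem using key
  have hsqrt : Tendsto Nat.sqrt atTop atTop := tendsto_atTop.2 fun b => by
    filter_upwards [eventually_ge_atTop (b * b)] with n hn
    exact Nat.le_sqrt.2 hn
  refine ⟨x, z, squeeze_zero (fun _ => dist_nonneg) hxz
    ((tendsto_one_div_add_atTop_nhds_zero_nat (𝕜 := ℝ)).comp hsqrt), fun r => ?_⟩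
  rw [frequently_atTop]
  intro N
  -- k ≥ 1 leaves room for the index i = k + 1, needed at r = 1.
  set k := N + 1 with hk
  have hk0 : (0 : ℝ) < (k : ℝ) + 1 := by positivity
  set i := ⌊(r : ℝ) * ((k : ℝ) + 1)⌋₊ with hi
  have hi1 : (i : ℝ) ≤ r * ((k : ℝ) + 1) := Nat.floor_le (mul_nonneg r.2.1 hk0.le)
  have hi2 : (r : ℝ) * ((k : ℝ) + 1) < i + 1 := Nat.lt_floor_add_one _
  have hik : i ≤ k + k := by
    have : (i : ℝ) ≤ (k : ℝ) + 1 := hi1.trans (by nlinarith [r.2.2])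
    have : i ≤ k + 1 := by exact_mod_cast this
    omega
  have hs : (k * k + i).sqrt = k := Nat.sqrt_add_eq k hik
  refine ⟨k * k + i, by nlinarith, fun t ht => hmem _ t ?_⟩
  rw [hs, Nat.add_sub_cancel_left, ht]
  exact ⟨(div_le_iff₀ hk0).2 hi1, (le_div_iff₀ hk0).2 hi2.le⟩

theorem not_hasSeparableCZeroExtensionProperty_of_uncountable (h : C(K, unitInterval))
    (hmono : Monotone h) (hunc : ¬ {r | ∃ t t', t < t' ∧ h t = r ∧ h t' = r}.Countable) :
    ¬ HasSeparableCZeroExtensionProperty C(K, ℝ) := by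
  intro hK
  have hne : Nonempty K := by
    by_contra hemp
    rw [not_nonempty_iff] at hemp
    refine hunc (Set.Countable.mono (s₂ := ∅) ?_ countable_empty)
    rintro r ⟨t, -⟩
    exact hemp.elim t
  obtain ⟨x, z, hxz, hfreq⟩ := exists_seq_forall_frequently_mem_Icc h
  set Rs := {r | ∃ t t', t < t' ∧ h t = r ∧ h t' = r} with hRs
  have hR : ∀ r : Rs, ∃ t t', t < t' ∧ h t = r ∧ h t' = r := fun r => r.2
  choose t t' htt ht ht' using hR
  have hur : ∀ r, ∃ f : C(K, ℝ), (∀ x, t' r ≤ x → f x = 0) ∧ (∀ x, x ≤ t r → f x = 1) ∧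
      ∀ x, f x ∈ Icc (0 : ℝ) 1 := fun r => by
    obtain ⟨f, h0, h1, h2⟩ := exists_continuous_zero_one_of_isClosed
      (isClosed_Ici (a := t' r)) (isClosed_Iic (a := t r))
      (disjoint_left.2 fun x hx hx' => ((htt r).trans_le (mem_Ici.1 hx)).not_ge hx')
    exact ⟨f, h0, h1, h2⟩
  choose f hf0 hf1 hf using hur
  let c : C(unitInterval, ℝ) →ₗ[ℝ] C(K, ℝ) := (ContinuousMap.compRightAlgHom ℝ ℝ h).toLinearMap
  have hc : Continuous c := ContinuousMap.compRightAlgHom_continuous ℝ ℝ h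
  let Y : Submodule ℝ C(K, ℝ) := (LinearMap.range c).topologicalClosure
  have hYsep : TopologicalSpace.SeparableSpace Y :=
    ((TopologicalSpace.isSeparable_range hc).closure).separableSpace
  let δ : ℕ → C(K, ℝ) →L[ℝ] ℝ := fun n =>
    ContinuousMap.evalCLM ℝ (x n) - ContinuousMap.evalCLM ℝ (z n)
  have hδ : ∀ n f, δ n f = f (x n) - f (z n) := fun n f => rfl
  have hδn : ∀ n, ‖δ n‖ ≤ 2 := fun n => by
    refine ContinuousLinearMap.opNorm_le_bound _ zero_le_two fun f => ?_
    rw [hδ]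
    have h1 := f.norm_coe_le_norm (x n)
    have h2 := f.norm_coe_le_norm (z n)
    linarith [norm_sub_le (f (x n)) (f (z n))]
  have hδY : ∀ y ∈ Y, Tendsto (fun n => δ n y) atTop (𝓝 0) := fun y hy => by
    refine tendsto_zero_of_forall_mem_closure hδn (s := range c) ?_ hy
    rintro _ ⟨g, rfl⟩
    have hu := CompactSpace.uniformContinuous_of_continuous g.continuous
    rw [Metric.uniformContinuous_iff] at hu
    rw [Metric.tendsto_nhds]
    intro ε hε
    obtain ⟨η, hη, hu⟩ := hu ε hε
    filter_upwards [Metric.tendsto_nhds.1 hxz η hη] with n hn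
    rw [Real.dist_0_eq_abs, abs_of_nonneg dist_nonneg] at hn
    rw [hδ, Real.dist_0_eq_abs]
    exact hu hn
  obtain ⟨T', hT'⟩ := (hK Y (Submodule.isClosed_topologicalClosure _)
    hYsep).exists_forall_apply_eq hδn hδY
  have hcount : (⋃ n, {r | ((CZero.coord n).comp T' - δ n) (f r) ≠ 0}).Countable := by
    refine countable_iUnion fun n => countable_apply_ne_zero_of_forall_comp h hmono ht ht' hf0 hf1
      hf _ fun g => ?_
    have hg : g.comp h ∈ Y := Submodule.le_topologicalClosure _ ⟨g, rfl⟩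
    rw [_root_.sub_apply, sub_eq_zero]
    exact hT' n _ hg
  have hex : ∃ r : Rs, ∀ n, ((CZero.coord n).comp T' - δ n) (f r) = 0 := by
    by_contra! hcon
    refine hunc (Set.countable_coe_iff.1 (Set.countable_univ_iff.1 (hcount.mono fun r _ => ?_)))
    obtain ⟨n, hn⟩ := hcon r
    exact mem_iUnion.2 ⟨n, hn⟩
  obtain ⟨r, hr⟩ := hex
  have hlim := (CZero.tendsto (T' (f r))).eventually (gt_mem_nhds (zero_lt_one))
  -- For such n the interval contains t r and t' r, so f r is 1 at x n and 0 at z n.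
  obtain ⟨n, hn, hn'⟩ := ((hfreq r).and_eventually hlim).exists
  have h1 : T' (f r) n = f r (x n) - f r (z n) := sub_eq_zero.1 (hr n)
  rw [h1, hf1 r _ (hn _ (ht r)).1, hf0 r _ (hn _ (ht' r)).2] at hn'
  norm_num at hn'

end CompactLine

/-! ### Metrizability of separable closed subsets -/

theorem finite_fiber_of_dense {K : Type*} [LinearOrder K] [TopologicalSpace K]
    [OrderTopology K] {S : Set K} {D : Set S} (hD : Dense D) {h : K → unitInterval}
    (hmono : Monotone h) (hlt : ∀ p ∈ D, ∀ q ∈ D, p < q → h p < h q) (r : unitInterval) :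
    {s | s ∈ S ∧ h s = r}.Finite := by
  by_contra hinf
  -- Among five points of a fibre, the gaps around the middle one contain two points of D, which h
  -- would have to separate.
  obtain ⟨F, hF, hcard⟩ := Set.Infinite.exists_subset_card_eq hinf 5
  let e := F.orderEmbOfFin hcard
  have heF : ∀ i, e i ∈ S ∧ h (e i) = r := fun i => hF (F.orderEmbOfFin_mem hcard i)
  have key : ∀ i j k, i < j → j < k → ∃ d ∈ D, (d : K) ∈ Ioo (e i) (e k) := by
    intro i j k hij hjk
    obtain ⟨d, hd, hdD⟩ := hD.exists_mem_open
      (isOpen_Ioo.preimage continuous_subtype_val : IsOpen ((↑) ⁻¹' Ioo (e i) (e k) : Set S))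
      ⟨⟨e j, (heF j).1⟩, e.strictMono hij, e.strictMono hjk⟩
    exact ⟨d, ‹_›, ‹_›⟩
  obtain ⟨c, hc, hc'⟩ := key 0 1 2 (by decide) (by decide)
  obtain ⟨d, hd, hd'⟩ := key 2 3 4 (by decide) (by decide)
  have h1 := hlt c hc d hd (hc'.2.trans hd'.1)
  have h2 := hmono hc'.1.le
  have h3 := hmono hd'.2.le
  rw [(heF 0).2] at h2
  rw [(heF 4).2] at h3
  exact (h1.trans_le h3).not_ge h2

section CompactLine

variable {K : Type*} [LinearOrder K] [TopologicalSpace K] [OrderTopology K] [CompactSpace K]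

/-- Urysohn's lemma for compact lines, with a monotone function. -/
theorem exists_monotone_zero_one {p q : K} (hpq : p < q) :
    ∃ f : C(K, ℝ), Monotone f ∧ (∀ x, f x ∈ Icc (0 : ℝ) 1) ∧ (∀ x, x ≤ p → f x = 0) ∧
      ∀ x, q ≤ x → f x = 1 := by
  obtain ⟨f, h0, h1, h2⟩ := exists_continuous_zero_one_of_isClosed
    (isClosed_Iic (a := p)) (isClosed_Ici (a := q))
    (disjoint_left.2 fun x hx hx' => (hpq.trans_le (mem_Ici.1 hx')).not_ge hx)
  have hne : Nonempty K := ⟨p⟩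
  have hbdd : ∀ x, BddAbove ((fun y => f (min x y)) '' univ) := fun x =>
    ⟨1, by rintro _ ⟨y, -, rfl⟩; exact (h2 _).2⟩
  have hle : ∀ x y, f (min x y) ≤ sSup ((fun y => f (min x y)) '' univ) := fun x y =>
    le_csSup (hbdd x) ⟨y, mem_univ _, rfl⟩
  -- The running supremum of f over points ≤ x is monotone and, by compactness, continuous.
  refine ⟨⟨fun x => sSup ((fun y => f (min x y)) '' univ),
    isCompact_univ.continuous_sSup (by fun_prop)⟩, fun x x' hx => ?_, fun x => ⟨?_, ?_⟩,
    fun x hx => le_antisymm ?_ ?_, fun x hx => le_antisymm ?_ ?_⟩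
  · refine csSup_le_csSup (hbdd x') (univ_nonempty.image _) ?_
    rintro _ ⟨y, -, rfl⟩
    refine ⟨min x y, mem_univ _, ?_⟩
    simp only [← min_assoc, min_eq_right hx]
  · exact (h2 _).1.trans (hle x x)
  · refine csSup_le (univ_nonempty.image _) ?_
    rintro _ ⟨y, -, rfl⟩
    exact (h2 _).2
  · refine csSup_le (univ_nonempty.image _) ?_
    rintro _ ⟨y, -, rfl⟩
    exact (h0 ((min_le_left x y).trans hx)).le
  · exact (h2 _).1.trans (hle x x)
  · refine csSup_le (univ_nonempty.image _) ?_
    rintro _ ⟨y, -, rfl⟩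
    exact (h2 _).2
  · have := hle x x
    rw [min_self, h1 hx] at this
    exact this

theorem exists_monotone_forall_lt {Q : Set K} (hQ : Q.Countable) :
    ∃ h : C(K, unitInterval), Monotone h ∧ ∀ p ∈ Q, ∀ q ∈ Q, p < q → h p < h q := by
  rcases Q.eq_empty_or_nonempty with rfl | hne
  · exact ⟨ContinuousMap.const K 0, fun _ _ _ => le_rfl, by simp⟩
  obtain ⟨u, rfl⟩ := hQ.exists_eq_range hne
  have hg : ∀ n : ℕ, ∃ g : C(K, ℝ), Monotone g ∧ (∀ x, g x ∈ Icc (0 : ℝ) 1) ∧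
      (u n.unpair.1 < u n.unpair.2 → g (u n.unpair.1) < g (u n.unpair.2)) := fun n => by
    by_cases hn : u n.unpair.1 < u n.unpair.2
    · obtain ⟨g, h1, h2, h3, h4⟩ := exists_monotone_zero_one hn
      refine ⟨g, h1, h2, fun _ => ?_⟩
      rw [h3 _ le_rfl, h4 _ le_rfl]
      exact one_pos
    · exact ⟨0, fun _ _ _ => le_rfl, fun x => by simp, fun h' => absurd h' hn⟩
  choose g hgm hg01 hgu using hg
  have hw : Summable fun n : ℕ => (1 / 2 : ℝ) ^ (n + 1) :=
    (summable_nat_add_iff 1).2 summable_geometric_two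
  have hw1 : ∑' n : ℕ, (1 / 2 : ℝ) ^ (n + 1) = 1 := by
    simp only [pow_succ, tsum_mul_right, tsum_geometric_two]
    norm_num
  have hterm : ∀ x n, (1 / 2 : ℝ) ^ (n + 1) * g n x ≤ (1 / 2 : ℝ) ^ (n + 1) := fun x n =>
    mul_le_of_le_one_right (by positivity) (hg01 n x).2
  have hterm0 : ∀ x n, 0 ≤ (1 / 2 : ℝ) ^ (n + 1) * g n x := fun x n =>
    mul_nonneg (by positivity) (hg01 n x).1
  have hs : ∀ x, Summable fun n => (1 / 2 : ℝ) ^ (n + 1) * g n x := fun x =>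
    hw.of_nonneg_of_le (hterm0 x) (hterm x)
  have hcont : Continuous fun x => ∑' n, (1 / 2 : ℝ) ^ (n + 1) * g n x :=
    continuous_tsum (fun n => by fun_prop) hw fun n x => by
      rw [Real.norm_of_nonneg (hterm0 x n)]
      exact hterm x n
  refine ⟨⟨fun x => ⟨∑' n, (1 / 2 : ℝ) ^ (n + 1) * g n x, tsum_nonneg (hterm0 x),
    ((hs x).tsum_le_tsum (hterm x) hw).trans_eq hw1⟩, hcont.subtype_mk _⟩, fun x y hxy => ?_, ?_⟩
  · exact (hs x).tsum_le_tsum (fun n => mul_le_mul_of_nonneg_left (hgm n hxy) (by positivity)) (hs y)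
  · rintro _ ⟨i, rfl⟩ _ ⟨j, rfl⟩ hij
    refine Subtype.mk_lt_mk.2 (Summable.tsum_lt_tsum (i := Nat.pair i j)
      (fun n => mul_le_mul_of_nonneg_left (hgm n hij.le) (by positivity)) ?_ (hs _) (hs _))
    have := hgu (Nat.pair i j)
    rw [Nat.unpair_pair] at this
    exact mul_lt_mul_of_pos_left (this hij) (by positivity)

/-- The points of S in nontrivial fibres of h form a countable set P. Together, h and one function
for each pair in P embed S in a metrizable space. -/
theorem metrizableSpace_of_forall_countable_fibers
    (hK : ∀ h : C(K, unitInterval), Monotone h →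
      {r | ∃ t t', t < t' ∧ h t = r ∧ h t' = r}.Countable)
    {S : Set K} (hS : IsClosed S) [TopologicalSpace.SeparableSpace S] :
    TopologicalSpace.MetrizableSpace S := by
  obtain ⟨D, hDc, hD⟩ := TopologicalSpace.exists_countable_dense S
  obtain ⟨h, hmono, hlt⟩ := exists_monotone_forall_lt (hDc.image ((↑) : S → K))
  have hlt' : ∀ p ∈ D, ∀ q ∈ D, p < q → h p < h q := fun p hp q hq hpq =>
    hlt p ⟨p, hp, rfl⟩ q ⟨q, hq, rfl⟩ hpq
  set R := {r | ∃ t t', t < t' ∧ h t = r ∧ h t' = r} with hR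
  set P : Set K := ⋃ r ∈ R, {s | s ∈ S ∧ h s = r} with hP
  have hPc : P.Countable := (hK h hmono).biUnion fun r _ =>
    (finite_fiber_of_dense hD hmono hlt' r).countable
  have := hPc.to_subtype
  have hur : ∀ p : P × P, ∃ f : C(K, ℝ), (p.1 : K) < p.2 → f p.1 ≠ f p.2 := fun p => by
    by_cases hp : (p.1 : K) < p.2
    · obtain ⟨f, -, -, h3, h4⟩ := exists_monotone_zero_one hp
      exact ⟨f, fun _ => by rw [h3 _ le_rfl, h4 _ le_rfl]; exact zero_ne_one⟩
    · exact ⟨0, fun h' => absurd h' hp⟩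
  choose f hf using hur
  let Φ : S → unitInterval × (P × P → ℝ) := fun s => (h s, fun p => f p s)
  have hΦ : Continuous Φ := by fun_prop
  have : CompactSpace S := isCompact_iff_compactSpace.1 hS.isCompact
  have hinj : Function.Injective Φ := by
    suffices H : ∀ s t : S, s < t → Φ s ≠ Φ t by
      intro s t hst
      by_contra hne
      rcases lt_or_gt_of_ne hne with h1 | h1
      · exact H s t h1 hst
      · exact H t s h1 hst.symm
    intro s t hst hΦst
    have h1 : h s = h t := congrArg Prod.fst hΦst
    have hr : h t ∈ R := ⟨s, t, hst, h1, rfl⟩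
    have hs : (s : K) ∈ P := mem_biUnion hr ⟨s.2, h1⟩
    have ht : (t : K) ∈ P := mem_biUnion hr ⟨t.2, rfl⟩
    exact hf (⟨s, hs⟩, ⟨t, ht⟩) hst (congrFun (congrArg Prod.snd hΦst) (⟨s, hs⟩, ⟨t, ht⟩))
  exact (hΦ.isClosedEmbedding hinj).isEmbedding.metrizableSpace

theorem HasSeparableCZeroExtensionProperty.isAlephZeroMonolithic
    (hK : HasSeparableCZeroExtensionProperty C(K, ℝ)) : IsAlephZeroMonolithic K := by
  intro S hS
  have hsep : TopologicalSpace.SeparableSpace (closure S) := by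
    obtain ⟨D, hDc, hD⟩ := TopologicalSpace.exists_countable_dense S
    have : closure (((↑) : S → K) '' D) = closure S := by
      refine subset_antisymm (closure_mono (Subtype.coe_image_subset S D))
        (closure_minimal ?_ isClosed_closure)
      exact Subtype.dense_iff.1 hD
    rw [← this]
    exact separableSpace_closure (hDc.image _)
  have : TopologicalSpace.MetrizableSpace (closure S) :=
    metrizableSpace_of_forall_countable_fibers (fun h hmono => by
      by_contra hunc
      exact not_hasSeparableCZeroExtensionProperty_of_uncountable h hmono hunc hK) isClosed_closure
  exact (Topology.IsEmbedding.inclusion subset_closure).metrizableSpace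

theorem HasCZeroExtensionProperty.hasSeparableCZeroExtensionProperty {X : Type*}
    [NormedAddCommGroup X] [NormedSpace ℝ X] (hX : HasCZeroExtensionProperty X) :
    HasSeparableCZeroExtensionProperty X :=
  fun Y hY _ => hX Y hY

end CompactLine

/-! ### Approximate extensions and copies of c₀ -/

section Approximation

variable {X : Type*} [NormedAddCommGroup X] [NormedSpace ℝ X]

theorem exists_approximate_extension {Y : Submodule ℝ X} {ψ : ℕ → X →L[ℝ] ℝ} {C η : ℝ}
    (hC : ∀ n, ‖ψ n‖ ≤ C) (hη : 0 ≤ η) {W : ℕ → Submodule ℝ X} (hW : Monotone W)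
    (hdense : ∀ x, x ∈ closure (⋃ k, (W k : Set X)))
    (h : ∀ k, ∀ᶠ n in atTop, ∀ y ∈ Y, ∀ w ∈ W k, |ψ n y| ≤ C * ‖y - w‖ + η * ‖y‖) :
    ∃ R : X →L[ℝ] CZero, ∀ y ∈ Y, ∀ n, |R y n - ψ n y| ≤ η * ‖y‖ := by
  have hC0 : 0 ≤ C := (norm_nonneg _).trans (hC 0)
  obtain ⟨κ, hκ, hev⟩ := exists_tendsto_atTop_eventually_of_forall_eventually h
  have hall : ∀ n, ∃ γ : X →L[ℝ] ℝ, ‖γ‖ ≤ C ∧ (∀ y ∈ Y, |γ y - ψ n y| ≤ η * ‖y‖) ∧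
      ((∀ y ∈ Y, ∀ w ∈ W (κ n), |ψ n y| ≤ C * ‖y - w‖ + η * ‖y‖) → ∀ w ∈ W (κ n), γ w = 0) :=
    fun n => by
    by_cases hn : ∀ y ∈ Y, ∀ w ∈ W (κ n), |ψ n y| ≤ C * ‖y - w‖ + η * ‖y‖
    · obtain ⟨γ, h1, h2, h3⟩ := exists_dual_of_le_dist (ψ n) hC0 hη hn
      exact ⟨γ, h1, h3, fun _ => h2⟩
    · exact ⟨ψ n, hC n, fun y _ => by simpa using mul_nonneg hη (norm_nonneg y),
        fun h' => absurd h' hn⟩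
  choose γ hγ hγY hγW using hall
  have hnull : ∀ x, Tendsto (fun n => γ n x) atTop (𝓝 0) := fun x => by
    refine tendsto_zero_of_forall_mem_closure hγ ?_ (hdense x)
    intro w hw
    obtain ⟨k, hk⟩ := mem_iUnion.1 hw
    refine tendsto_const_nhds.congr' ?_
    filter_upwards [hev, hκ.eventually_ge_atTop k] with n h1 h2
    exact (hγW n h1 w (hW h2 hk)).symm
  obtain ⟨R, hR⟩ := exists_continuousLinearMap_cZero γ hγ hnull
  exact ⟨R, fun y hy n => by rw [hR]; exact hγY n y hy⟩

/-- U = R S⁻¹ is within 1/2 of the identity, hence invertible, and S⁻¹ U⁻¹ R is a projection. -/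
theorem Submodule.closedComplemented_of_norm_sub_le {Y : Submodule ℝ X} (S : Y ≃L[ℝ] CZero)
    (R : X →L[ℝ] CZero) (h : ∀ y : Y, ‖R y - S y‖ ≤ 1 / 2 * ‖S y‖) : Y.ClosedComplemented := by
  let U : CZero →L[ℝ] CZero := (R.comp Y.subtypeL).comp (S.symm : CZero →L[ℝ] Y)
  have hU : ‖1 - U‖ < 1 := by
    refine lt_of_le_of_lt (ContinuousLinearMap.opNorm_le_bound _ (by norm_num) fun a => ?_)
      (one_half_lt_one (α := ℝ))
    have := h (S.symm a)
    rw [S.apply_symm_apply, norm_sub_rev] at this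
    exact this
  let V : (CZero →L[ℝ] CZero)ˣ := Units.oneSub (1 - U) hU
  have hV : ∀ a, (↑V⁻¹ : CZero →L[ℝ] CZero) (U a) = a := fun a => by
    have h1 : (V : CZero →L[ℝ] CZero) = U := sub_sub_cancel 1 U
    have h2 := V.inv_mul
    rw [h1] at h2
    exact congrArg (fun T : CZero →L[ℝ] CZero => T a) h2
  refine ⟨((S.symm : CZero →L[ℝ] Y).comp (↑V⁻¹ : CZero →L[ℝ] CZero)).comp R, fun y => ?_⟩
  have h1 := hV (S y)
  have h2 : U (S y) = R y := by simp [U]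
  rw [h2] at h1
  rw [ContinuousLinearMap.comp_apply, ContinuousLinearMap.comp_apply, h1]
  exact S.symm_apply_apply y

/-- The unit vector basis of `c₀`. -/
noncomputable def CZero.single (m : ℕ) : CZero :=
  CZero.mk (Pi.single m 1) (tendsto_const_nhds.congr' (by
    filter_upwards [eventually_gt_atTop m] with n hn
    rw [Pi.single_eq_of_ne hn.ne']))

theorem CZero.sum_smul_single_apply (F : Finset ℕ) (c : ℕ → ℝ) (n : ℕ) :
    (∑ m ∈ F, c m • CZero.single m) n = if n ∈ F then c n else 0 := by
  have := map_sum (CZero.coord n) (fun m => c m • CZero.single m) F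
  rw [CZero.coord_apply] at this
  rw [this]
  simp [CZero.single, Pi.single_apply]

theorem CZero.tendsto_sum_smul_single (a : CZero) :
    Tendsto (fun J => ∑ m ∈ Finset.range J, a m • CZero.single m) atTop (𝓝 a) := by
  rw [Metric.tendsto_atTop]
  intro ε hε
  obtain ⟨N, hN⟩ := Metric.tendsto_atTop.1 (CZero.tendsto a) (ε / 2) (by positivity)
  refine ⟨N, fun J hJ => ?_⟩
  rw [dist_eq_norm]
  refine lt_of_le_of_lt (CZero.norm_le (by positivity) fun n => ?_) (half_lt_self hε)
  rw [ZeroAtInftyContinuousMap.sub_apply, CZero.sum_smul_single_apply]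
  split_ifs with h
  · simp only [sub_self, abs_zero]
    positivity
  · have h1 : J ≤ n := by simpa using h
    have := hN n (hJ.trans h1)
    rw [Real.dist_0_eq_abs] at this
    rw [zero_sub, abs_neg]
    exact this.le

variable (L : CZero →L[ℝ] X) (φ : X →L[ℝ] ℝ)

theorem sum_abs_apply_single_le (hφ : ‖φ‖ ≤ 1) (F : Finset ℕ) :
    ∑ m ∈ F, |φ (L (CZero.single m))| ≤ ‖L‖ := by
  have hsign : ∀ m, ∃ c : ℝ, |c| ≤ 1 ∧ c * φ (L (CZero.single m)) = |φ (L (CZero.single m))| :=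
    fun m => by
    rcases abs_choice (φ (L (CZero.single m))) with h1 | h1
    · exact ⟨1, by simp, by rw [one_mul, h1]⟩
    · exact ⟨-1, by simp, by rw [h1]; ring⟩
  choose c hc hcm using hsign
  have h1 : φ (L (∑ m ∈ F, c m • CZero.single m)) = ∑ m ∈ F, |φ (L (CZero.single m))| := by
    simp only [map_sum, map_smul, smul_eq_mul, hcm]
  have h2 : ‖∑ m ∈ F, c m • CZero.single m‖ ≤ 1 := by
    refine CZero.norm_le zero_le_one fun n => ?_
    rw [CZero.sum_smul_single_apply]
    split_ifs
    · exact hc n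
    · simp
  rw [← h1]
  refine (le_abs_self _).trans ((φ.le_of_opNorm_le hφ _).trans ?_)
  rw [one_mul]
  exact L.unit_le_opNorm _ h2

theorem abs_apply_le_of_sum_Ico_le (hφ : ‖φ‖ ≤ 1) {ε τ : ℝ} {k : ℕ}
    (hε : ∀ J, ∑ m ∈ Finset.Ico k J, |φ (L (CZero.single m))| ≤ ε) {d : CZero} (hτ : 0 ≤ τ)
    (hd : ∀ m < k, |d m| ≤ τ) : |φ (L d)| ≤ τ * ‖L‖ + ‖d‖ * ε := by
  have hlim : Tendsto (fun J => |φ (L (∑ m ∈ Finset.range J, d m • CZero.single m))|) atTop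
      (𝓝 |φ (L d)|) :=
    ((φ.comp L).continuous.tendsto _ |>.comp (CZero.tendsto_sum_smul_single d)).abs
  refine le_of_tendsto hlim ?_
  filter_upwards [eventually_ge_atTop k] with J hJ
  have h1 : φ (L (∑ m ∈ Finset.range J, d m • CZero.single m)) =
      ∑ m ∈ Finset.range k, d m * φ (L (CZero.single m)) +
        ∑ m ∈ Finset.Ico k J, d m * φ (L (CZero.single m)) := by
    rw [Finset.sum_range_add_sum_Ico _ hJ]
    simp only [map_sum, map_smul, smul_eq_mul]
  rw [h1]
  refine (abs_add_le _ _).trans (add_le_add ?_ ?_)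
  · refine (Finset.abs_sum_le_sum_abs _ _).trans ?_
    refine (Finset.sum_le_sum (g := fun m => τ * |φ (L (CZero.single m))|) fun m hm => ?_).trans ?_
    · rw [abs_mul]
      exact mul_le_mul_of_nonneg_right (hd m (Finset.mem_range.1 hm)) (abs_nonneg _)
    · rw [← Finset.mul_sum]
      exact mul_le_mul_of_nonneg_left (sum_abs_apply_single_le L φ hφ _) hτ
  · refine (Finset.abs_sum_le_sum_abs _ _).trans ?_
    refine (Finset.sum_le_sum (g := fun m => ‖d‖ * |φ (L (CZero.single m))|) fun m _ => ?_).trans ?_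
    · rw [abs_mul]
      exact mul_le_mul_of_nonneg_right (CZero.abs_apply_le d m) (abs_nonneg _)
    · rw [← Finset.mul_sum]
      exact mul_le_mul_of_nonneg_left (hε J) (norm_nonneg _)

end Approximation

/-! ### Tail sets and functions constant on their intervals -/

section Tails

variable {K : Type*} [TopologicalSpace K]

/-- The open set of points at which the tail from `k` on of the series of absolute values of the
images of the unit vectors of `c₀` exceeds `ε`. -/
def tailSet (L : CZero →L[ℝ] C(K, ℝ)) (ε : ℝ) (k : ℕ) : Set K :=
  {x | ∃ J, ε < ∑ m ∈ Finset.Ico k J, |L (CZero.single m) x|}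

variable (L : CZero →L[ℝ] C(K, ℝ)) (ε : ℝ)

theorem isOpen_tailSet (k : ℕ) : IsOpen (tailSet L ε k) := by
  rw [tailSet, Set.ofPred_exists]
  exact isOpen_iUnion fun J => isOpen_lt continuous_const (by fun_prop)

theorem antitone_tailSet : Antitone (tailSet L ε) := fun _ _ hkl _ ⟨J, hJ⟩ =>
  ⟨J, hJ.trans_le (Finset.sum_le_sum_of_subset_of_nonneg (Finset.Ico_subset_Ico_left hkl)
    fun _ _ _ => abs_nonneg _)⟩

/-- The continuous functions which are constant on intervals contained in `V`, up to and including
the left end points of these. -/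
def constOn [LinearOrder K] (V : Set K) : Submodule ℝ C(K, ℝ) where
  carrier := {u | ∀ z x, z < x → Ioc z x ⊆ V → u z = u x}
  zero_mem' _ _ _ _ := rfl
  add_mem' hu hv z x hzx hV := by
    rw [ContinuousMap.add_apply, ContinuousMap.add_apply, hu z x hzx hV, hv z x hzx hV]
  smul_mem' c u hu z x hzx hV := by
    rw [ContinuousMap.smul_apply, ContinuousMap.smul_apply, hu z x hzx hV]

theorem constOn_antitone [LinearOrder K] : Antitone (constOn (K := K)) := fun _ _ hVV _ hu z x hzx hV =>
  hu z x hzx (hV.trans hVV)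

variable [CompactSpace K]

theorem norm_evalCLM_le_one (x : K) : ‖(ContinuousMap.evalCLM ℝ x : C(K, ℝ) →L[ℝ] ℝ)‖ ≤ 1 :=
  ContinuousLinearMap.opNorm_le_bound _ zero_le_one fun f => by
    rw [one_mul]
    exact f.norm_coe_le_norm x

theorem exists_notMem_tailSet {ε : ℝ} (hε : 0 < ε) (x : K) : ∃ k, x ∉ tailSet L ε k := by
  have hs : Summable fun m => |L (CZero.single m) x| :=
    summable_of_sum_le (fun _ => abs_nonneg _)
      fun F => sum_abs_apply_single_le L (ContinuousMap.evalCLM ℝ x) (norm_evalCLM_le_one x) F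
  obtain ⟨k, hk⟩ := (hs.hasSum.tendsto_sum_nat.eventually
    (lt_mem_nhds (sub_lt_self _ hε))).exists
  refine ⟨k, fun ⟨J, hJ⟩ => ?_⟩
  rcases le_total k J with h | h
  · rw [Finset.sum_Ico_eq_sub _ h] at hJ
    have := hs.sum_le_tsum (Finset.range J) (fun _ _ => abs_nonneg _)
    linarith
  · rw [Finset.Ico_eq_empty_of_le h, Finset.sum_empty] at hJ
    linarith

variable [LinearOrder K]

/-- Stone–Weierstrass: the union is an increasing union of subalgebras. At a jump p ⋖ q the
indicator of [q, ∞) is continuous and belongs to `constOn (V k)` once q ∉ V k. -/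
theorem mem_closure_iUnion_constOn [OrderTopology K]
    (hK : ∀ x y : K, x < y → ∃ p q, p ⋖ q ∧ x ≤ p ∧ q ≤ y) {V : ℕ → Set K} (hV : Antitone V)
    (hV' : ∀ x, ∃ k, x ∉ V k) (f : C(K, ℝ)) : f ∈ closure (⋃ k, (constOn (V k) : Set C(K, ℝ))) := by
  have hmono : ∀ {k l}, k ≤ l → constOn (V k) ≤ constOn (V l) := fun hkl =>
    constOn_antitone (hV hkl)
  let A : Subalgebra ℝ C(K, ℝ) :=
    { carrier := ⋃ k, (constOn (V k) : Set C(K, ℝ))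
      mul_mem' := fun {u v} hu hv => by
        obtain ⟨k, hk⟩ := mem_iUnion.1 hu
        obtain ⟨l, hl⟩ := mem_iUnion.1 hv
        refine mem_iUnion.2 ⟨max k l, fun z x hzx hxV => ?_⟩
        rw [ContinuousMap.mul_apply, ContinuousMap.mul_apply,
          hmono (le_max_left k l) hk z x hzx hxV, hmono (le_max_right k l) hl z x hzx hxV]
      add_mem' := fun {u v} hu hv => by
        obtain ⟨k, hk⟩ := mem_iUnion.1 hu
        obtain ⟨l, hl⟩ := mem_iUnion.1 hv
        exact mem_iUnion.2 ⟨max k l, add_mem (hmono (le_max_left k l) hk)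
          (hmono (le_max_right k l) hl)⟩
      algebraMap_mem' := fun r => mem_iUnion.2 ⟨0, fun _ _ _ _ => rfl⟩ }
  have hA : A.SeparatesPoints := by
    have key : ∀ x y : K, x < y → ∃ u ∈ A, u x ≠ u y := by
      intro x y hxy
      obtain ⟨p, q, hpq, hxp, hqy⟩ := hK x y hxy
      obtain ⟨u, h0, h1, -⟩ := exists_continuous_zero_one_of_isClosed
        (isClosed_Iic (a := p)) (isClosed_Ici (a := q))
        (disjoint_left.2 fun z hz hz' => (hpq.1.trans_le (mem_Ici.1 hz')).not_ge hz)
      obtain ⟨k, hk⟩ := hV' q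
      refine ⟨u, mem_iUnion.2 ⟨k, fun z w hzw hwV => ?_⟩, ?_⟩
      · rcases le_or_gt w p with h | h
        · rw [h0 h, h0 (hzw.le.trans h)]
          rfl
        · have hqw : q ≤ w := not_lt.1 (hpq.2 h)
          have hqz : q ≤ z := not_lt.1 fun hzq => hk (hwV ⟨hzq, hqw⟩)
          rw [h1 hqw, h1 hqz]
          rfl
      · rw [h0 hxp, h1 hqy]
        exact zero_ne_one
    intro x y hxy
    rcases lt_or_gt_of_ne hxy with h | h
    · obtain ⟨u, hu, hne⟩ := key x y h
      exact ⟨u, ⟨u, hu, rfl⟩, hne⟩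
    · obtain ⟨u, hu, hne⟩ := key y x h
      exact ⟨u, ⟨u, hu, rfl⟩, hne.symm⟩
  have htop := ContinuousMap.subalgebra_topologicalClosure_eq_top_of_separatesPoints A hA
  have hf : f ∈ A.topologicalClosure := htop ▸ Algebra.mem_top
  exact hf

/-- From x in the tail set, go down to the last point z outside it, which exists since ⊥ is outside.
There L d is small and u z = u x, so two comparisons of L d with u suffice. -/
theorem norm_apply_le_of_mem_constOn [OrderTopology K] [OrderBot K] {ε : ℝ} {k : ℕ}
    (hbot : ⊥ ∉ tailSet L ε k) (d : CZero) {τ : ℝ} (hτ : 0 ≤ τ) (hε : 0 ≤ ε)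
    (hd : ∀ m < k, |d m| ≤ τ) {u : C(K, ℝ)} (hu : u ∈ constOn (tailSet L ε k)) :
    ‖L d‖ ≤ 2 * ‖L d - u‖ + (τ * ‖L‖ + ‖d‖ * ε) := by
  have hout : ∀ x ∉ tailSet L ε k, |L d x| ≤ τ * ‖L‖ + ‖d‖ * ε := fun x hx =>
    abs_apply_le_of_sum_Ico_le L (ContinuousMap.evalCLM ℝ x) (norm_evalCLM_le_one x)
      (fun J => not_lt.1 fun hJ => hx ⟨J, hJ⟩) hτ hd
  have hsub : ∀ x, |L d x - u x| ≤ ‖L d - u‖ := fun x => (L d - u).norm_coe_le_norm x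
  rw [ContinuousMap.norm_le _ (by positivity)]
  intro x
  rw [Real.norm_eq_abs]
  by_cases hx : x ∈ tailSet L ε k
  · obtain ⟨z, ⟨hzV, hzx⟩, hz⟩ :=
      ((isOpen_tailSet L ε k).isClosed_compl.inter (isClosed_Iic (a := x))).isCompact.exists_isGreatest
        ⟨⊥, hbot, bot_le⟩
    have hlt : z < x := lt_of_le_of_ne hzx fun h => hzV (h ▸ hx)
    have huz : u z = u x := hu z x hlt fun y hy => by
      by_contra hyV
      exact (hz ⟨hyV, hy.2⟩).not_gt hy.1
    have h1 := abs_le.1 (hout z hzV)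
    have h2 := abs_le.1 (hsub z)
    have h3 := abs_le.1 (hsub x)
    exact abs_le.2 ⟨by linarith, by linarith⟩
  · have := hout x hx
    linarith [norm_nonneg (L d - u)]

end Tails

/-! ### The Sobczyk property -/

section Sobczyk

variable {K : Type*} [LinearOrder K] [TopologicalSpace K] [OrderTopology K] [CompactSpace K]

theorem hasSobczykProperty_of_forall_exists_covBy [OrderBot K]
    (hK : ∀ x y : K, x < y → ∃ p q, p ⋖ q ∧ x ≤ p ∧ q ≤ y) : HasSobczykProperty C(K, ℝ) := by
  rintro Y - ⟨S⟩
  set L : CZero →L[ℝ] C(K, ℝ) := Y.subtypeL.comp (S.symm : CZero →L[ℝ] Y) with hL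
  have hLS : ∀ y : Y, L (S y) = y := fun y => by simp [hL]
  set T : Y →L[ℝ] CZero := (S : Y →L[ℝ] CZero) with hT
  set C := ‖T‖ + 1 with hC
  have hC0 : 0 < C := by positivity
  have hext : ∀ n, ∃ ψ : C(K, ℝ) →L[ℝ] ℝ, (∀ y : Y, ψ y = S y n) ∧ ‖ψ‖ ≤ C := fun n => by
    obtain ⟨ψ, h1, h2⟩ := exists_extension_norm_eq Y ((CZero.coord n).comp T)
    exact ⟨ψ, h1, (h2.trans_le (CZero.norm_coord_comp_le T n)).trans (by linarith)⟩
  choose ψ hψ hψC using hext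
  -- Chosen so that η‖y‖ ≤ ‖S y‖/2; ε below makes the compactness error, multiplied by C, equal to
  -- η/2.
  set η := 1 / (2 * (‖L‖ + 1)) with hη
  have hη0 : 0 < η := by positivity
  set ε := η / (2 * C * (‖L‖ + 2 * C)) with hε
  have hε0 : 0 < ε := by positivity
  obtain ⟨k₀, hk₀⟩ := exists_notMem_tailSet L hε0 (⊥ : K)
  have hbot : ∀ k, ⊥ ∉ tailSet L ε (k + k₀) := fun k h =>
    hk₀ (antitone_tailSet L ε (Nat.le_add_left k₀ k) h)
  obtain ⟨R, hR⟩ := exists_approximate_extension (Y := Y) (ψ := ψ) (C := 2 * C * 2) (η := η)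
    (W := fun k => constOn (tailSet L ε (k + k₀))) (fun n => (hψC n).trans (by linarith)) hη0.le
    (fun k l hkl => constOn_antitone (antitone_tailSet L ε (Nat.add_le_add_right hkl k₀)))
    (mem_closure_iUnion_constOn hK
      (fun k l hkl => antitone_tailSet L ε (Nat.add_le_add_right hkl k₀)) fun x => by
        obtain ⟨k, hk⟩ := exists_notMem_tailSet L hε0 x
        exact ⟨k, fun h => hk (antitone_tailSet L ε (Nat.le_add_right k k₀) h)⟩) fun k => by
      refine eventually_abs_le_norm_sub (ε := ε * ‖L‖ + 2 * C * ε) hC0 hψC (fun y hy => ?_)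
        one_le_two hη0.le ?_ ?_
      · exact (CZero.tendsto (S ⟨y, hy⟩)).congr fun n => (hψ n ⟨y, hy⟩).symm
      · have : C * (ε * ‖L‖ + 2 * C * ε) = η / 2 := by
          rw [hε]
          field_simp
        linarith
      · intro y w hy hy1 hw _
        have hSn : ∀ j, ‖S ⟨y j, hy j⟩‖ ≤ C := fun j =>
          (T.unit_le_opNorm ⟨y j, hy j⟩ (hy1 j)).trans (by linarith)
        -- Only the first k + k₀ coordinates need to be Cauchy; later ones are handled by the tail
        -- sets.
        obtain ⟨a, -, φ, hφ, ha⟩ := tendsto_subseq_of_bounded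
          (Metric.isBounded_closedBall (x := (0 : Fin (k + k₀) → ℝ)) (r := C))
          (x := fun j m => S ⟨y j, hy j⟩ m) (fun j => by
            rw [mem_closedBall_zero_iff, pi_norm_le_iff_of_nonneg hC0.le]
            exact fun m => (CZero.abs_apply_le _ _).trans (hSn j))
        obtain ⟨N, hN⟩ := Metric.cauchySeq_iff.1 ha.cauchySeq ε hε0
        refine ⟨fun j => φ (N + j), hφ.comp fun i j h => by simpa using h, fun i j => ?_⟩
        set i' := φ (N + i)
        set j' := φ (N + j)
        have hd : ‖S ⟨y i', hy i'⟩ - S ⟨y j', hy j'⟩‖ ≤ 2 * C :=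
          (norm_sub_le _ _).trans (by linarith [hSn i', hSn j'])
        have hLd : L (S ⟨y i', hy i'⟩ - S ⟨y j', hy j'⟩) = y i' - y j' := by
          rw [map_sub, hLS, hLS]
        have := norm_apply_le_of_mem_constOn L (hbot k) (S ⟨y i', hy i'⟩ - S ⟨y j', hy j'⟩)
          hε0.le hε0.le (fun m hm => by
            have h1 := hN (N + i) (by simp) (N + j) (by simp)
            exact ((dist_pi_le_iff hε0.le).1 h1.le ⟨m, hm⟩)) (sub_mem (hw i') (hw j'))
        rw [hLd] at this
        have h2 : ‖y i' - y j' - (w i' - w j')‖ ≤ ‖y i' - w i'‖ + ‖y j' - w j'‖ := by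
          rw [sub_sub_sub_comm]
          exact norm_sub_le _ _
        have h3 := mul_le_mul_of_nonneg_right hd hε0.le
        linarith
  refine Submodule.closedComplemented_of_norm_sub_le S R fun y => ?_
  have h1 : ‖R y - S y‖ ≤ η * ‖(y : C(K, ℝ))‖ := CZero.norm_le (by positivity) fun n => by
    have := hR y y.2 n
    rwa [hψ] at this
  have h2 : ‖(y : C(K, ℝ))‖ ≤ (‖L‖ + 1) * ‖S y‖ := by
    have := L.le_opNorm (S y)
    rw [hLS] at this
    linarith [norm_nonneg (S y)]
  refine h1.trans ((mul_le_mul_of_nonneg_left h2 hη0.le).trans_eq ?_)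
  rw [hη]
  field_simp

end Sobczyk

/-! ### Jumps and fibres of the double arrow space -/

namespace DoubleArrow

theorem exists_covBy {x y : DoubleArrow} (hxy : x < y) : ∃ p q, p ⋖ q ∧ x ≤ p ∧ q ≤ y := by
  have hcov : ∀ t : unitInterval, (toLex (t, 0) : DoubleArrow) ⋖ toLex (t, 1) := fun t => by
    refine ⟨Prod.Lex.lt_iff.2 (Or.inr ⟨rfl, by simp⟩), fun c h1 h2 => ?_⟩
    rcases Prod.Lex.lt_iff.1 h1 with h1 | ⟨h1, h1'⟩ <;>
      rcases Prod.Lex.lt_iff.1 h2 with h2 | ⟨h2, h2'⟩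
    · exact (h1.trans h2).false
    · exact h1.ne' h2
    · exact h2.ne' h1
    · simp only [ofLex_toLex] at h1' h2'
      omega
  rcases Prod.Lex.lt_iff.1 hxy with h | ⟨h, h'⟩
  · obtain ⟨t, ht, ht'⟩ := exists_between h
    exact ⟨_, _, hcov t, Prod.Lex.le_iff.2 (Or.inl ht), Prod.Lex.le_iff.2 (Or.inl ht')⟩
  · refine ⟨_, _, hcov (ofLex x).1, Prod.Lex.le_iff.2 (Or.inr ⟨rfl, ?_⟩),
      Prod.Lex.le_iff.2 (Or.inr ⟨h, ?_⟩)⟩ <;> simp only [ofLex_toLex] <;> omega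

theorem not_hasSeparableCZeroExtensionProperty :
    ¬ HasSeparableCZeroExtensionProperty C(DoubleArrow, ℝ) := by
  have hmono : Monotone fun x : DoubleArrow => (ofLex x).1 := Prod.Lex.monotone_fst_ofLex
  refine not_hasSeparableCZeroExtensionProperty_of_uncountable
    ⟨fun x => (ofLex x).1, hmono.continuous_of_surjective fun t => ⟨toLex (t, 0), rfl⟩⟩ hmono
    fun hcount => ?_
  have huniv : {r | ∃ t t' : DoubleArrow, t < t' ∧ (ofLex t).1 = r ∧ (ofLex t').1 = r} = univ :=
    eq_univ_of_forall fun r => ⟨toLex (r, 0), toLex (r, 1),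
      Prod.Lex.lt_iff.2 (Or.inr ⟨rfl, by simp⟩), rfl, rfl⟩
  have h1 : (univ : Set unitInterval).Countable := huniv ▸ hcount
  have h2 : (Icc (0 : ℝ) 1).Countable := Set.countable_coe_iff.1 (Set.countable_univ_iff.1 h1)
  exact Cardinal.Real.Icc_countable_iff.1 h2 |>.not_gt one_pos

end DoubleArrow

theorem theorem2p2 :
    (∀ (K : Type*) [LinearOrder K] [TopologicalSpace K] [OrderTopology K] [CompactSpace K],
      List.TFAE [IsAlephZeroMonolithic K, HasCZeroExtensionProperty C(K, ℝ),
        HasSeparableCZeroExtensionProperty C(K, ℝ)]) ∧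
    HasSobczykProperty C(DoubleArrow, ℝ) ∧
    ¬ HasSeparableCZeroExtensionProperty C(DoubleArrow, ℝ) := by
  refine ⟨fun K _ _ _ _ => ?_,
    hasSobczykProperty_of_forall_exists_covBy fun _ _ => DoubleArrow.exists_covBy,
    DoubleArrow.not_hasSeparableCZeroExtensionProperty⟩
  tfae_have 1 → 2 := IsAlephZeroMonolithic.hasCZeroExtensionProperty
  tfae_have 2 → 3 := HasCZeroExtensionProperty.hasSeparableCZeroExtensionProperty
  tfae_have 3 → 1 := HasSeparableCZeroExtensionProperty.isAlephZeroMonolithic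
  tfae_finish
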